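/- For $n\ge 2$ the $n$-dimensional locally twisted cube $LTQ_n$ is the graph on the set $\{0,1\}^n$ of binary sequences defined recursively as follows. $LTQ_2$ is the $4$-cycle in which two sequences are adjacent if and only if they differ in exactly one bit. For $n\ge 3$, $LTQ_n$ consists of two disjoint copies of $LTQ_{n-1}$, the labels of one prefixed with $0$ and those of the other prefixed with $1$, together with the edges that join each $0x_2x_3\cdots x_n$ to $1(x_2+x_n)x_3\cdots x_n$, where $+$ is addition modulo $2$. The crossing number $cr(G)$ of a graph $G$ is the minimum number of pairwise intersections of edges (not counting common end vertices) in a drawing of $G$ in the plane, where a drawing represents the vertices by distinct points and each edge by a simple arc joining its end vertices and passing through no other vertex. **Theorem.** For every integer $n\ge 6$, $$cr(LTQ_n)\le \frac{265}{6}\,4^{n-4}-\left(n^2+\frac{15+(-1)^{n-1}}{6}\right)2^{n-3}.$$ -/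

import Mathlib

/-- The `n`-dimensional hypercube: vertices are the 0-1 sequences of length `n`, and two of them are
adjacent when they differ in exactly one bit. -/
def hypercubeGraph (n : ℕ) : SimpleGraph (Fin n → ZMod 2) where
  Adj x y := hammingDist x y = 1
  symm := ⟨fun x y h => by rwa [hammingDist_comm]⟩
  loopless := ⟨fun x h => by simp at h⟩

/-- For a sequence `x = 0 x₂ x₃ … xₙ` with `n = m + 3`, the sequence `1 (x₂ + xₙ) x₃ … xₙ`
(the bit `xᵢ` is `x (i - 1)`, and the addition is modulo 2). -/
def twistedPartner {m : ℕ} (x : Fin (m + 3) → ZMod 2) : Fin (m + 3) → ZMod 2 :=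
  Function.update (Function.update x 0 1) 1 (x 1 + x (Fin.last (m + 2)))

/-- Two copies of a graph `G`, with the labels of one prefixed by `0` and those of the other by `1`,
where each `x = 0 x₂ x₃ … xₙ` is moreover joined to `1 (x₂ + xₙ) x₃ … xₙ`. -/
def locallyTwistedStep {m : ℕ} (G : SimpleGraph (Fin (m + 2) → ZMod 2)) :
    SimpleGraph (Fin (m + 3) → ZMod 2) where
  Adj x y :=
    (x 0 = y 0 ∧ G.Adj (Fin.tail x) (Fin.tail y)) ∨
    (x 0 = 0 ∧ y = twistedPartner x) ∨
    (y 0 = 0 ∧ x = twistedPartner y)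
  symm := ⟨by
    rintro x y (⟨h, h'⟩ | h | h)
    · exact Or.inl ⟨h.symm, h'.symm⟩
    · exact Or.inr (Or.inr h)
    · exact Or.inr (Or.inl h)⟩
  loopless := ⟨by
    have key : ∀ x : Fin (m + 3) → ZMod 2, ¬ (x 0 = 0 ∧ x = twistedPartner x) := by
      rintro x ⟨h0, h⟩
      have h1 := congrFun h 0
      rw [h0] at h1
      simp [twistedPartner] at h1
    rintro x (⟨-, h⟩ | h | h)
    · exact G.loopless.irrefl _ h
    · exact key x h
    · exact key x h⟩

/-- The locally twisted cube `LTQₙ`, for `n ≥ 2`. (The cases `n = 0, 1` are conventional.) -/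
def LTQ : (n : ℕ) → SimpleGraph (Fin n → ZMod 2)
  | 0 => hypercubeGraph 0
  | 1 => hypercubeGraph 1
  | 2 => hypercubeGraph 2
  | m + 3 => locallyTwistedStep (LTQ (m + 2))

/-- A drawing of a graph in the plane: distinct vertices are distinct points, and every edge is a
simple arc that joins its two end vertices and passes through no vertex in its interior. -/
structure PlaneDrawing {V : Type*} (G : SimpleGraph V) where
  /-- The position of each vertex. -/
  point : V → ℝ × ℝ
  point_injective : Function.Injective point
  /-- A parametrization of the arc that represents each edge. -/
  arc : G.edgeSet → unitInterval → ℝ × ℝ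
  arc_continuous : ∀ e, Continuous (arc e)
  arc_injective : ∀ e, Function.Injective (arc e)
  arc_ends : ∀ e, s(arc e 0, arc e 1) = Sym2.map point e.1
  arc_avoids : ∀ e, ∀ t ∈ Set.Ioo (0 : unitInterval) 1, ∀ v, arc e t ≠ point v

namespace PlaneDrawing

variable {V : Type*} {G : SimpleGraph V}

/-- The arc of an edge without its two ends. -/
def openArc (D : PlaneDrawing G) (e : G.edgeSet) : Set (ℝ × ℝ) :=
  D.arc e '' Set.Ioo 0 1

/-- The crossings of a drawing: an unordered pair of distinct edges together with a point at which
the two edges meet, other than at a common end. Every pairwise intersection counts, so a point where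
three edges meet counts three times, and a point where two edges merely touch counts as well. -/
def crossings (D : PlaneDrawing G) : Set (Sym2 G.edgeSet × (ℝ × ℝ)) :=
  {c | ¬ c.1.IsDiag ∧ ∀ e ∈ c.1, c.2 ∈ D.openArc e}

end PlaneDrawing

/-- The crossing number of a graph: the minimum number of crossings in a drawing of the graph in the
plane (`⊤` if there is no drawing with finitely many crossings). -/
noncomputable def crossingNumber {V : Type*} (G : SimpleGraph V) : ℕ∞ :=
  ⨅ D : PlaneDrawing G, D.crossings.encard

/-- A drawing of a graph with its vertices on a horizontal line, the spine, in which every edge is a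
semicircle above or below the spine. -/
structure SpineDrawing {W : Type*} (H : SimpleGraph W) where
  /-- The position of each vertex on the spine. -/
  pos : W → ℕ
  pos_injective : Function.Injective pos
  /-- Whether the edge that joins two vertices is drawn above the spine. -/
  side : W → W → Bool
  side_comm : ∀ a b, side a b = side b a

namespace SpineDrawing

variable {V W : Type*} {H : SimpleGraph W}

open scoped Classical in
/-- The pairs of edges on the same side of the spine whose ends interleave: `(a, b, c, d)` stands
for the edges `ab` and `cd`, where `a < c < b < d` on the spine. -/
noncomputable def interleavings [Fintype W] (D : SpineDrawing H) : Finset (W × W × W × W) :=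
  {q | H.Adj q.1 q.2.1 ∧ H.Adj q.2.2.1 q.2.2.2 ∧ D.side q.1 q.2.1 = D.side q.2.2.1 q.2.2.2 ∧
    D.pos q.1 < D.pos q.2.2.1 ∧ D.pos q.2.2.1 < D.pos q.2.1 ∧ D.pos q.2.1 < D.pos q.2.2.2}

/-- The sign of the half-plane that contains the edge between two vertices. -/
def sign (D : SpineDrawing H) (a b : W) : ℝ := if D.side a b then 1 else -1

lemma sign_comm (D : SpineDrawing H) (a b : W) : D.sign a b = D.sign b a := by
  simp only [sign, D.side_comm a b]

lemma sign_ne_zero (D : SpineDrawing H) (a b : W) : D.sign a b ≠ 0 := by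
  unfold sign; split_ifs <;> norm_num

lemma sign_mul_self (D : SpineDrawing H) (a b : W) : D.sign a b * D.sign a b = 1 := by
  unfold sign; split_ifs <;> norm_num

/-- The open semicircle that represents the edge between two vertices. -/
def openBow (D : SpineDrawing H) (a b : W) : Set (ℝ × ℝ) :=
  {z | 0 < D.sign a b * z.2 ∧ z.2 ^ 2 = (z.1 - D.pos a) * (D.pos b - z.1)}

lemma openBow_comm (D : SpineDrawing H) (a b : W) : D.openBow a b = D.openBow b a := by
  ext z
  simp only [openBow, Set.mem_ofPred_eq, D.sign_comm a b]
  rw [show (z.1 - D.pos a) * (D.pos b - z.1) = (z.1 - D.pos b) * (D.pos a - z.1) by ring]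

lemma snd_ne_zero_of_mem_openBow {D : SpineDrawing H} {a b : W} {z : ℝ × ℝ}
    (hz : z ∈ D.openBow a b) : z.2 ≠ 0 := by
  rintro h
  have := hz.1
  simp [h] at this

lemma side_eq_of_mem_openBow {D : SpineDrawing H} {a b c d : W} {z : ℝ × ℝ}
    (h₁ : z ∈ D.openBow a b) (h₂ : z ∈ D.openBow c d) : D.side a b = D.side c d := by
  have h₁ := h₁.1
  have h₂ := h₂.1
  unfold sign at h₁ h₂
  split_ifs at h₁ h₂ <;> first | linarith | simp_all

/-- Two semicircles that meet have interleaving ends, or both ends in common. -/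
lemma interleave_of_mem_openBow {D : SpineDrawing H} {a b c d : W} {z : ℝ × ℝ}
    (h₁ : z ∈ D.openBow a b) (h₂ : z ∈ D.openBow c d) (hab : D.pos a < D.pos b)
    (hcd : D.pos c < D.pos d) :
    (a = c ∧ b = d) ∨ (D.pos a < D.pos c ∧ D.pos c < D.pos b ∧ D.pos b < D.pos d) ∨
      (D.pos c < D.pos a ∧ D.pos a < D.pos d ∧ D.pos d < D.pos b) := by
  have hy : 0 < z.2 ^ 2 := by
    have := snd_ne_zero_of_mem_openBow h₁
    positivity
  have e₁ := h₁.2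
  have e₂ := h₂.2
  have hab' : (D.pos a : ℝ) < D.pos b := by exact_mod_cast hab
  have hcd' : (D.pos c : ℝ) < D.pos d := by exact_mod_cast hcd
  have between : ∀ p q : ℝ, p < q → 0 < (z.1 - p) * (q - z.1) → p < z.1 ∧ z.1 < q := by
    intro p q hpq h
    rcases pos_and_pos_or_neg_and_neg_of_mul_pos h with h | h
    · exact ⟨by linarith [h.1], by linarith [h.2]⟩
    · linarith [h.1, h.2]
  obtain ⟨ha, hb⟩ := between _ _ hab' (e₁ ▸ hy)
  obtain ⟨hc, hd⟩ := between _ _ hcd' (e₂ ▸ hy)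
  have hcb : D.pos c < D.pos b := by exact_mod_cast hc.trans hb
  have had : D.pos a < D.pos d := by exact_mod_cast ha.trans hd
  rcases lt_trichotomy (D.pos a) (D.pos c) with hac | hac | hac
  · refine Or.inr (Or.inl ⟨hac, hcb, ?_⟩)
    by_contra! hdb
    have hac' : (D.pos a : ℝ) < D.pos c := by exact_mod_cast hac
    have hdb' : (D.pos d : ℝ) ≤ D.pos b := by exact_mod_cast hdb
    nlinarith
  · have hac' : (D.pos a : ℝ) = D.pos c := by exact_mod_cast hac
    have : (z.1 - D.pos a) * (D.pos b - z.1) = (z.1 - D.pos a) * (D.pos d - z.1) := by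
      rw [← e₁, e₂, hac']
    have hbd := mul_left_cancel₀ (sub_pos.2 ha).ne' this
    have hbd : (D.pos b : ℝ) = D.pos d := by linarith
    exact Or.inl ⟨D.pos_injective hac, D.pos_injective (by exact_mod_cast hbd)⟩
  · refine Or.inr (Or.inr ⟨hac, had, ?_⟩)
    by_contra! hdb
    have hac' : (D.pos c : ℝ) < D.pos a := by exact_mod_cast hac
    have hdb' : (D.pos b : ℝ) ≤ D.pos d := by exact_mod_cast hdb
    nlinarith

/-- Two semicircles with interleaving ends have at most one point in common. -/
lemma eq_of_mem_openBow {D : SpineDrawing H} {a b c d : W} {z w : ℝ × ℝ}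
    (hz₁ : z ∈ D.openBow a b) (hz₂ : z ∈ D.openBow c d) (hw₁ : w ∈ D.openBow a b)
    (hw₂ : w ∈ D.openBow c d) (hac : D.pos a < D.pos c) (hbd : D.pos b < D.pos d) : z = w := by
  have hac' : (D.pos a : ℝ) < D.pos c := by exact_mod_cast hac
  have hbd' : (D.pos b : ℝ) < D.pos d := by exact_mod_cast hbd
  have ez : (z.1 - D.pos a) * (D.pos b - z.1) = (z.1 - D.pos c) * (D.pos d - z.1) :=
    hz₁.2.symm.trans hz₂.2
  have ew : (w.1 - D.pos a) * (D.pos b - w.1) = (w.1 - D.pos c) * (D.pos d - w.1) :=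
    hw₁.2.symm.trans hw₂.2
  have hx : z.1 = w.1 := by
    have : (z.1 - w.1) * ((D.pos c + D.pos d : ℝ) - (D.pos a + D.pos b)) = 0 := by linarith
    rcases mul_eq_zero.1 this with h | h
    · linarith
    · linarith
  have hy : (D.sign a b * z.2) ^ 2 = (D.sign a b * w.2) ^ 2 := by
    rw [mul_pow, mul_pow, hz₁.2, hw₁.2, hx]
  have hy' : D.sign a b * z.2 = D.sign a b * w.2 :=
    (pow_left_inj₀ hz₁.1.le hw₁.1.le two_ne_zero).1 hy
  exact Prod.ext hx (mul_left_cancel₀ (D.sign_ne_zero a b) hy')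

/-- The point of the plane that represents a vertex. -/
def spinePoint (D : SpineDrawing H) (a : W) : ℝ × ℝ := (D.pos a, 0)

lemma spinePoint_injective (D : SpineDrawing H) : Function.Injective D.spinePoint := by
  intro a b h
  have := (Prod.ext_iff.1 h).1
  exact D.pos_injective (by simpa [spinePoint] using this)

lemma pos_cast_ne (D : SpineDrawing H) {a b : W} (hab : a ≠ b) : (D.pos a : ℝ) ≠ D.pos b :=
  fun h => hab (D.pos_injective (by exact_mod_cast h))

/-- The semicircle between two vertices, as a curve. -/
lemma exists_bow (D : SpineDrawing H) {a b : W} (hab : a ≠ b) :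
    ∃ γ : unitInterval → ℝ × ℝ, Continuous γ ∧ Function.Injective γ ∧ γ 0 = D.spinePoint a ∧
      γ 1 = D.spinePoint b ∧ ∀ t ∈ Set.Ioo (0 : unitInterval) 1, γ t ∈ D.openBow a b := by
  have hne := D.pos_cast_ne hab
  set p : ℝ := (D.pos a : ℝ) with hp
  set q : ℝ := (D.pos b : ℝ) with hq
  refine ⟨fun t => (p + t * (q - p), D.sign a b * (|q - p| * √(t * (1 - t)))), by fun_prop,
    ?_, ?_, ?_, ?_⟩
  · intro s t h
    have h1 := (Prod.ext_iff.1 h).1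
    simp only [add_right_inj] at h1
    exact Subtype.ext (mul_right_cancel₀ (sub_ne_zero.2 hne.symm) h1)
  · simp [spinePoint, hp]
  · simp [spinePoint, hq]
  · rintro t ⟨ht0, ht1⟩
    have ht0' : (0 : ℝ) < t := ht0
    have ht1' : (t : ℝ) < 1 := ht1
    have hpos : 0 < (t : ℝ) * (1 - t) := mul_pos ht0' (by linarith)
    refine ⟨?_, ?_⟩
    · dsimp only
      rw [← mul_assoc, sign_mul_self, one_mul]
      exact mul_pos (abs_pos.2 (sub_ne_zero.2 hne.symm)) (Real.sqrt_pos.2 hpos)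
    · dsimp only
      rw [mul_pow, mul_pow, sq_abs, Real.sq_sqrt hpos.le, pow_two, sign_mul_self, ← hp, ← hq]
      ring

/-- The curve that follows a semicircle to a point of the spine, and then one on the other side. -/
lemma exists_double_bow (D : SpineDrawing H) {a b d : W} (hab : a ≠ b) (had : a ≠ d) (hdb : d ≠ b)
    (hside : D.side a d ≠ D.side d b) :
    ∃ γ : unitInterval → ℝ × ℝ, Continuous γ ∧ Function.Injective γ ∧ γ 0 = D.spinePoint a ∧
      γ 1 = D.spinePoint b ∧ ∀ t ∈ Set.Ioo (0 : unitInterval) 1,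
        γ t ∈ D.openBow a d ∨ γ t ∈ D.openBow d b ∨ γ t = D.spinePoint d := by
  have hne := D.pos_cast_ne hab
  have hne₁ := D.pos_cast_ne had
  have hne₂ := D.pos_cast_ne hdb
  have hsign : D.sign d b = - D.sign a d := by
    unfold sign
    revert hside
    cases D.side a d <;> cases D.side d b <;> simp
  have hs := D.sign_ne_zero a d
  have hs2 := D.sign_mul_self a d
  set p : ℝ := (D.pos a : ℝ) with hp
  set q : ℝ := (D.pos b : ℝ) with hq
  set r : ℝ := (D.pos d : ℝ) with hr
  set σ := D.sign a d with hσ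
  set x : ℝ → ℝ := fun t => p + min (2 * t) 1 * (r - p) + max (2 * t - 1) 0 * (q - r) with hx
  set y : ℝ → ℝ := fun t => σ * (|r - p| * √(2 * t * (1 - 2 * t))
    - |q - r| * √((2 * t - 1) * (2 - 2 * t))) with hy
  have hrp : 0 < |r - p| := abs_pos.2 (sub_ne_zero.2 hne₁.symm)
  have hqr : 0 < |q - r| := abs_pos.2 (sub_ne_zero.2 hne₂.symm)
  have xl : ∀ t : ℝ, t ≤ 1 / 2 → x t = p + 2 * t * (r - p) := by
    intro t ht
    simp only [hx]
    rw [min_eq_left (by linarith), max_eq_right (by linarith)]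
    ring
  have xr : ∀ t : ℝ, 1 / 2 ≤ t → x t = r + (2 * t - 1) * (q - r) := by
    intro t ht
    simp only [hx]
    rw [min_eq_right (by linarith), max_eq_left (by linarith)]
    ring
  have yl : ∀ t : ℝ, 0 ≤ t → t ≤ 1 / 2 → y t = σ * (|r - p| * √(2 * t * (1 - 2 * t))) := by
    intro t h0 ht
    simp only [hy]
    rw [Real.sqrt_eq_zero_of_nonpos (x := (2 * t - 1) * (2 - 2 * t))
      (mul_nonpos_of_nonpos_of_nonneg (by linarith) (by linarith))]
    ring
  have yr : ∀ t : ℝ, 1 / 2 ≤ t → t ≤ 1 →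
      y t = -σ * (|q - r| * √((2 * t - 1) * (2 - 2 * t))) := by
    intro t ht h1
    simp only [hy]
    rw [Real.sqrt_eq_zero_of_nonpos (x := 2 * t * (1 - 2 * t))
      (mul_nonpos_of_nonneg_of_nonpos (by linarith) (by linarith))]
    ring
  have mixed : ∀ s t : ℝ, 0 ≤ s → s ≤ 1 / 2 → 1 / 2 ≤ t → t ≤ 1 → x s = x t → y s = y t →
      s = t := by
    intro s t hs0 hs1 ht0 ht1 hxe hye
    rw [yl s hs0 hs1, yr t ht0 ht1, neg_mul, ← mul_neg] at hye
    have hye := mul_left_cancel₀ hs hye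
    have n1 := mul_nonneg hrp.le (Real.sqrt_nonneg (2 * s * (1 - 2 * s)))
    have n2 := mul_nonneg hqr.le (Real.sqrt_nonneg ((2 * t - 1) * (2 - 2 * t)))
    have z1 : √(2 * s * (1 - 2 * s)) = 0 :=
      (mul_eq_zero.1 (by linarith : |r - p| * √(2 * s * (1 - 2 * s)) = 0)).resolve_left hrp.ne'
    have z2 : √((2 * t - 1) * (2 - 2 * t)) = 0 :=
      (mul_eq_zero.1
        (by linarith : |q - r| * √((2 * t - 1) * (2 - 2 * t)) = 0)).resolve_left hqr.ne'
    have z1 := (Real.sqrt_eq_zero (mul_nonneg (by linarith) (by linarith))).1 z1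
    have z2 := (Real.sqrt_eq_zero (mul_nonneg (by linarith) (by linarith))).1 z2
    rw [xl s hs1, xr t ht0] at hxe
    rcases mul_eq_zero.1 z1 with hs' | hs' <;> rcases mul_eq_zero.1 z2 with ht' | ht'
    · exact absurd (by rw [hs', ht'] at hxe; linarith) hne₁
    · rw [hs', show 2 * t - 1 = 1 by linarith] at hxe
      exact absurd (by linarith) hne
    · linarith
    · rw [show 2 * s = 1 by linarith, show 2 * t - 1 = 1 by linarith] at hxe
      exact absurd (by linarith) hne₂
  refine ⟨fun t => (x t, y t), by fun_prop, ?_, ?_, ?_, ?_⟩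
  · intro s t h
    obtain ⟨h1, h2⟩ := Prod.ext_iff.1 h
    dsimp only at h1 h2
    apply Subtype.ext
    rcases le_total (s : ℝ) (1 / 2) with hs' | hs' <;>
      rcases le_total (t : ℝ) (1 / 2) with ht' | ht'
    · rw [xl _ hs', xl _ ht'] at h1
      have := mul_right_cancel₀ (sub_ne_zero.2 hne₁.symm) (add_left_cancel h1)
      linarith
    · exact mixed _ _ s.2.1 hs' ht' t.2.2 h1 h2
    · exact (mixed _ _ t.2.1 ht' hs' s.2.2 h1.symm h2.symm).symm
    · rw [xr _ hs', xr _ ht'] at h1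
      have := mul_right_cancel₀ (sub_ne_zero.2 hne₂.symm) (add_left_cancel h1)
      linarith
  · have h1 := xl 0 (by norm_num)
    have h2 := yl 0 le_rfl (by norm_num)
    simp [spinePoint, h1, h2, hp]
  · have h1 := xr 1 (by norm_num)
    have h2 := yr 1 (by norm_num) le_rfl
    simp only [spinePoint, Set.Icc.coe_one, h1, h2, hq]
    norm_num
  · rintro t ⟨ht0, ht1⟩
    have ht0' : (0 : ℝ) < t := ht0
    have ht1' : (t : ℝ) < 1 := ht1
    rcases lt_trichotomy (t : ℝ) (1 / 2) with ht | ht | ht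
    · left
      have hpos : 0 < 2 * (t : ℝ) * (1 - 2 * t) := mul_pos (by linarith) (by linarith)
      refine ⟨?_, ?_⟩ <;> dsimp only <;> rw [yl _ ht0'.le ht.le]
      · rw [← mul_assoc, ← hσ, hs2, one_mul]
        exact mul_pos hrp (Real.sqrt_pos.2 hpos)
      · rw [xl _ ht.le, mul_pow, mul_pow, sq_abs, Real.sq_sqrt hpos.le, pow_two, hs2]
        ring
    · right; right
      have h1 := xl t ht.le
      have h2 := yl t ht0'.le ht.le
      rw [ht] at h1 h2
      simp only [spinePoint, ht]
      rw [h1, h2]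
      norm_num
      exact hr
    · right; left
      have hpos : 0 < (2 * (t : ℝ) - 1) * (2 - 2 * t) := mul_pos (by linarith) (by linarith)
      refine ⟨?_, ?_⟩ <;> dsimp only <;> rw [yr _ ht.le ht1'.le]
      · rw [← mul_assoc, hsign, neg_mul_neg, hs2, one_mul]
        exact mul_pos hqr (Real.sqrt_pos.2 hpos)
      · rw [xr _ ht.le, mul_pow, mul_pow, sq_abs, Real.sq_sqrt hpos.le, neg_sq, pow_two, hs2]
        ring

/-- The part of the edge `e` of `G` that joins `a` and `b`, when the vertices of `G` are placed by
`ι` at vertices of `H` and its edges are edges of `H` or paths of length two in `H`. -/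
def Carries (H : SimpleGraph W) (ι : V → W) (e : Sym2 V) (a b : W) : Prop :=
  (∃ u v, e = s(u, v) ∧ s(a, b) = s(ι u, ι v)) ∨
    ∃ u v d, e = s(u, v) ∧ u ≠ v ∧ d ∉ Set.range ι ∧ H.Adj (ι u) d ∧ H.Adj (ι v) d ∧
      s(a, b) = s(ι u, d)

lemma Carries.symm {ι : V → W} {e : Sym2 V} {a b : W} (h : Carries H ι e a b) :
    Carries H ι e b a := by
  unfold Carries at *
  rwa [Sym2.eq_swap (a := b)]

lemma Carries.unique {ι : V → W} (hι : Function.Injective ι)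
    (hd : ∀ d ∉ Set.range ι, ∀ u v w, u ≠ v → H.Adj (ι u) d → H.Adj (ι v) d → H.Adj (ι w) d →
      w = u ∨ w = v) {e f : Sym2 V} {a b : W} (he : Carries H ι e a b) (hf : Carries H ι f a b) :
    e = f := by
  have key : ∀ {u d u' d'}, d ∉ Set.range ι → d' ∉ Set.range ι → s(ι u, d) = s(ι u', d') →
      u = u' ∧ d = d' := by
    intro u d u' d' h h' heq
    rcases Sym2.eq_iff.1 heq with ⟨h1, h2⟩ | ⟨h1, h2⟩
    · exact ⟨hι h1, h2⟩
    · exact absurd ⟨u, h1⟩ h'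
  have key' : ∀ {u v u' d}, d ∉ Set.range ι → s(ι u, ι v) ≠ s(ι u', d) := by
    intro u v u' d h heq
    rcases Sym2.eq_iff.1 heq with ⟨h1, h2⟩ | ⟨h1, h2⟩
    · exact h ⟨v, h2⟩
    · exact h ⟨u, h1⟩
  rcases he with ⟨u, v, rfl, h⟩ | ⟨u, v, d, rfl, huv, hdr, hu, hv, h⟩ <;>
    rcases hf with ⟨u', v', rfl, h'⟩ | ⟨u', v', d', rfl, huv', hdr', hu', hv', h'⟩
  · rw [h] at h'
    exact Sym2.map.injective hι (by simpa using h')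
  · exact absurd (h.symm.trans h') (key' hdr')
  · exact absurd (h'.symm.trans h) (key' hdr)
  · obtain ⟨rfl, rfl⟩ := key hdr hdr' (h.symm.trans h')
    rcases hd _ hdr _ _ _ huv hu hv hv' with rfl | rfl
    · exact absurd rfl huv'
    · rfl

/-- A graph whose edges are edges, or paths of length two, in a graph drawn on a spine has at most
as many crossings as there are interleavings. The middle of each path of length two is used by that
path only, and the path changes sides there. -/
theorem crossingNumber_le [Fintype W] (D : SpineDrawing H) {G : SimpleGraph V} {ι : V → W}
    (hι : Function.Injective ι)
    (hG : ∀ u v, G.Adj u v → H.Adj (ι u) (ι v) ∨ ∃ d, d ∉ Set.range ι ∧ H.Adj (ι u) d ∧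
      H.Adj d (ι v) ∧ D.side (ι u) d ≠ D.side d (ι v))
    (hd : ∀ d ∉ Set.range ι, ∀ u v w, u ≠ v → H.Adj (ι u) d → H.Adj (ι v) d → H.Adj (ι w) d →
      w = u ∨ w = v) :
    crossingNumber G ≤ D.interleavings.card := by
  have curve : ∀ e : G.edgeSet, ∃ γ : unitInterval → ℝ × ℝ, Continuous γ ∧ Function.Injective γ ∧
      s(γ 0, γ 1) = Sym2.map (D.spinePoint ∘ ι) e.1 ∧ ∀ t ∈ Set.Ioo (0 : unitInterval) 1,
        (∃ a b, H.Adj a b ∧ Carries H ι e.1 a b ∧ γ t ∈ D.openBow a b) ∨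
        ∃ u v d, e.1 = s(u, v) ∧ u ≠ v ∧ d ∉ Set.range ι ∧ H.Adj (ι u) d ∧ H.Adj (ι v) d ∧
          γ t = D.spinePoint d := by
    rintro ⟨e, he⟩
    induction e using Sym2.ind with
    | _ u v =>
      have he : G.Adj u v := he
      have huv : ι u ≠ ι v := fun h => he.ne (hι h)
      rcases hG u v he with h | ⟨d, hdr, h₁, h₂, hs⟩
      · obtain ⟨γ, hc, hi, h0, h1, hγ⟩ := D.exists_bow huv
        exact ⟨γ, hc, hi, by simp [h0, h1], fun t ht =>
          Or.inl ⟨_, _, h, Or.inl ⟨u, v, rfl, rfl⟩, hγ t ht⟩⟩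
      · obtain ⟨γ, hc, hi, h0, h1, hγ⟩ := D.exists_double_bow huv h₁.ne h₂.ne hs
        refine ⟨γ, hc, hi, by simp [h0, h1], fun t ht => ?_⟩
        rcases hγ t ht with h | h | h
        · exact Or.inl ⟨_, _, h₁, Or.inr ⟨u, v, d, rfl, he.ne, hdr, h₁, h₂.symm, rfl⟩, h⟩
        · exact Or.inl ⟨_, _, h₂, Or.inr ⟨v, u, d, Sym2.eq_swap, he.ne', hdr, h₂.symm, h₁,
            Sym2.eq_swap⟩, h⟩
        · exact Or.inr ⟨u, v, d, rfl, he.ne, hdr, h₁, h₂.symm, h⟩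
  choose γ hγc hγi hγe hγ using curve
  let P : PlaneDrawing G :=
    { point := D.spinePoint ∘ ι
      point_injective := D.spinePoint_injective.comp hι
      arc := γ
      arc_continuous := hγc
      arc_injective := hγi
      arc_ends := hγe
      arc_avoids := by
        intro e t ht v heq
        rcases hγ e t ht with ⟨a, b, -, -, h⟩ | ⟨u, w, d, -, -, hdr, -, -, h⟩
        · exact snd_ne_zero_of_mem_openBow h (by rw [heq]; rfl)
        · exact hdr ⟨v, D.spinePoint_injective (heq.symm.trans h)⟩ }
  refine (iInf_le _ P).trans ?_
  have cross : ∀ c ∈ P.crossings, ∃ q ∈ D.interleavings, ∃ e f : G.edgeSet, c.1 = s(e, f) ∧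
      Carries H ι e.1 q.1 q.2.1 ∧ Carries H ι f.1 q.2.2.1 q.2.2.2 ∧
      c.2 ∈ D.openBow q.1 q.2.1 ∧ c.2 ∈ D.openBow q.2.2.1 q.2.2.2 := by
    rintro ⟨ef, z⟩ ⟨hne, hz⟩
    induction ef using Sym2.ind with
    | _ e f =>
      have hef : e ≠ f := by simpa using hne
      obtain ⟨t, ht, rfl⟩ := hz e (Sym2.mem_mk_left e f)
      obtain ⟨t', ht', hz'⟩ := hz f (Sym2.mem_mk_right e f)
      change γ f t' = γ e t at hz'
      change ∃ q ∈ D.interleavings, ∃ e' f' : G.edgeSet, s(e, f) = s(e', f') ∧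
        Carries H ι e'.1 q.1 q.2.1 ∧ Carries H ι f'.1 q.2.2.1 q.2.2.2 ∧
        γ e t ∈ D.openBow q.1 q.2.1 ∧ γ e t ∈ D.openBow q.2.2.1 q.2.2.2
      rcases hγ e t ht with ⟨a, b, hab, hca, hz₁⟩ | ⟨u, v, d, he, huv, hdr, hu, hv, hz₁⟩ <;>
        rcases hγ f t' ht' with ⟨a', b', hab', hca', hz₂⟩ |
          ⟨u', v', d', hf, huv', hdr', hu', hv', hz₂⟩ <;> rw [hz'] at hz₂
      · obtain ⟨a, b, hab, hca, hz₁, hlt⟩ : ∃ a b, H.Adj a b ∧ Carries H ι e.1 a b ∧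
            γ e t ∈ D.openBow a b ∧ D.pos a < D.pos b := by
          rcases lt_or_gt_of_ne (D.pos_injective.ne hab.ne) with h | h
          · exact ⟨a, b, hab, hca, hz₁, h⟩
          · exact ⟨b, a, hab.symm, hca.symm, D.openBow_comm a b ▸ hz₁, h⟩
        obtain ⟨c, d, hcd, hcc, hz₂, hlt'⟩ : ∃ c d, H.Adj c d ∧ Carries H ι f.1 c d ∧
            γ e t ∈ D.openBow c d ∧ D.pos c < D.pos d := by
          rcases lt_or_gt_of_ne (D.pos_injective.ne hab'.ne) with h | h
          · exact ⟨a', b', hab', hca', hz₂, h⟩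
          · exact ⟨b', a', hab'.symm, hca'.symm, D.openBow_comm a' b' ▸ hz₂, h⟩
        have hs := side_eq_of_mem_openBow hz₁ hz₂
        rcases interleave_of_mem_openBow hz₁ hz₂ hlt hlt' with ⟨rfl, rfl⟩ | h | h
        · exact absurd (Subtype.ext (Carries.unique hι hd hca hcc)) hef
        · exact ⟨(a, b, c, d), by simp [interleavings, hab, hcd, hs, h], e, f, rfl, hca, hcc,
            hz₁, hz₂⟩
        · exact ⟨(c, d, a, b), by simp [interleavings, hab, hcd, hs, h], f, e, Sym2.eq_swap,
            hcc, hca, hz₂, hz₁⟩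
      · exact absurd (by rw [hz₂]; rfl) (snd_ne_zero_of_mem_openBow hz₁)
      · exact absurd (by rw [hz₁]; rfl) (snd_ne_zero_of_mem_openBow hz₂)
      · obtain rfl := D.spinePoint_injective (hz₁.symm.trans hz₂)
        refine absurd (Subtype.ext (?_ : e.1 = f.1)) hef
        rw [he, hf]
        rcases hd d hdr u v u' huv hu hv hu' with rfl | rfl <;>
          rcases hd d hdr _ _ v' huv hu hv hv' with rfl | rfl
        · exact absurd rfl huv'
        · rfl
        · exact Sym2.eq_swap
        · exact absurd rfl huv'
  rcases P.crossings.eq_empty_or_nonempty with h0 | ⟨c₀, hc₀⟩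
  · simp [h0]
  have : Nonempty (W × W × W × W) := ⟨(cross c₀ hc₀).choose⟩
  choose! Q hQ hQ' using cross
  rw [← Set.encard_coe_eq_coe_finsetCard]
  refine Set.encard_le_encard_of_injOn (f := Q) (fun c hc => hQ c hc) ?_
  intro c hc c' hc' heq
  obtain ⟨e, f, h1, h2, h3, h4, h5⟩ := hQ' c hc
  obtain ⟨e', f', h1', h2', h3', h4', h5'⟩ := hQ' c' hc'
  have hlt := hQ c hc
  rw [← heq] at h2' h3' h4' h5'
  simp only [interleavings, Finset.mem_filter, Finset.mem_univ, true_and] at hlt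
  obtain ⟨-, -, -, hac, -, hbd⟩ := hlt
  have he := Subtype.ext (Carries.unique hι hd h2 h2')
  have hf := Subtype.ext (Carries.unique hι hd h3 h3')
  refine Prod.ext ?_ (eq_of_mem_openBow h4 h5 h4' h5' hac hbd)
  rw [h1, h1', he, hf]

end SpineDrawing

lemma ZMod.eq_zero_and_eq_one_of_val_lt : ∀ {x y : ZMod 2}, x.val < y.val → x = 0 ∧ y = 1 := by
  decide

namespace SpineDrawing

variable {V W : Type*} {H : SimpleGraph W}

open scoped Classical in
/-- The pairs of edges on the same side of the spine with a common end: `(v, b, d)` stands for the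
edges `vb` and `vd`, where `b < d` on the spine. -/
noncomputable def wedges [Fintype W] (D : SpineDrawing H) : Finset (W × W × W) :=
  {q | H.Adj q.1 q.2.1 ∧ H.Adj q.1 q.2.2 ∧ D.side q.1 q.2.1 = D.side q.1 q.2.2 ∧
    D.pos q.2.1 < D.pos q.2.2}

open scoped Classical in
/-- The edges at which the voltage `β` vanishes. -/
noncomputable def twists [Fintype W] (D : SpineDrawing H) (β : W → W → ZMod 2) : Finset (W × W) :=
  {q | H.Adj q.1 q.2 ∧ D.pos q.1 < D.pos q.2 ∧ β q.1 q.2 = 0}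

open scoped Classical in
/-- The neighbors of `v` along edges on a given side of the spine. -/
noncomputable def sideNeighbors [Fintype W] (D : SpineDrawing H) (s : Bool) (v : W) : Finset W :=
  {u | H.Adj v u ∧ D.side v u = s}

lemma mem_sideNeighbors [Fintype W] {D : SpineDrawing H} {s : Bool} {v u : W} :
    u ∈ D.sideNeighbors s v ↔ H.Adj v u ∧ D.side v u = s := by
  simp [sideNeighbors]

open scoped Classical in
/-- The number of interleavings when each vertex of a spine drawing is replaced by two consecutive
ones and each edge by two parallel ones, which cross each other only where the voltage `β` vanishes.
The two copies of a vertex may be adjacent. -/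
theorem card_interleavings_le_of_double [Fintype W] {W' : Type*} [Fintype W']
    {H' : SimpleGraph W'} (D : SpineDrawing H) (D' : SpineDrawing H') (β : W → W → ZMod 2)
    (π : W' → W) (bit : W' → ZMod 2)
    (hpos : ∀ w, D'.pos w = 2 * D.pos (π w) + (bit w).val)
    (hadj : ∀ w u, H'.Adj w u → π w ≠ π u → H.Adj (π w) (π u) ∧
      D'.side w u = D.side (π w) (π u) ∧ bit u = bit w + β (π w) (π u)) :
    D'.interleavings.card ≤ 4 * D.interleavings.card + D.wedges.card + (D.twists β).card := by
  let Φ : W' → W × ZMod 2 := fun w => (π w, bit w)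
  have hΦ : Function.Injective Φ := by
    intro w u h
    obtain ⟨h1, h2⟩ := Prod.ext_iff.1 h
    dsimp only [Φ] at h1 h2
    exact D'.pos_injective (by rw [hpos, hpos, h1, h2])
  let T₁ : Finset ((W × ZMod 2) × (W × ZMod 2) × (W × ZMod 2) × (W × ZMod 2)) :=
    (D.interleavings ×ˢ (Finset.univ : Finset (ZMod 2 × ZMod 2))).image fun p =>
      ((p.1.1, p.2.1), (p.1.2.1, p.2.1 + β p.1.1 p.1.2.1),
        (p.1.2.2.1, p.2.2), (p.1.2.2.2, p.2.2 + β p.1.2.2.1 p.1.2.2.2))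
  let T₂ : Finset ((W × ZMod 2) × (W × ZMod 2) × (W × ZMod 2) × (W × ZMod 2)) :=
    D.wedges.image fun p =>
      if D.pos p.1 < D.pos p.2.1 then
        ((p.1, 0), (p.2.1, 0 + β p.1 p.2.1), (p.1, 1), (p.2.2, 1 + β p.1 p.2.2))
      else if D.pos p.1 < D.pos p.2.2 then
        ((p.2.1, 1 - β p.2.1 p.1), (p.1, 1), (p.1, 0), (p.2.2, 0 + β p.1 p.2.2))
      else ((p.2.1, 0 - β p.2.1 p.1), (p.1, 0), (p.2.2, 1 - β p.2.2 p.1), (p.1, 1))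
  let T₃ : Finset ((W × ZMod 2) × (W × ZMod 2) × (W × ZMod 2) × (W × ZMod 2)) :=
    (D.twists β).image fun p => ((p.1, 0), (p.2, 0), (p.1, 1), (p.2, 1))
  have hT : D'.interleavings.card ≤ (T₁ ∪ T₂ ∪ T₃).card := by
    refine Finset.card_le_card_of_injOn
      (fun q => (Φ q.1, Φ q.2.1, Φ q.2.2.1, Φ q.2.2.2)) ?_ ?_
    · rintro ⟨a, b, c, d⟩ hq
      simp only [interleavings, Finset.coe_filter, Finset.mem_univ, true_and,
        Set.mem_ofPred_eq] at hq
      obtain ⟨hab, hcd, hs, hac, hcb, hbd⟩ := hq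
      rw [hpos, hpos] at hac hcb hbd
      have va := ZMod.val_lt (bit a)
      have vb := ZMod.val_lt (bit b)
      have vc := ZMod.val_lt (bit c)
      have vd := ZMod.val_lt (bit d)
      have nab : π a ≠ π b := by
        intro h
        rw [← h] at hcb
        omega
      have ncd : π c ≠ π d := by
        intro h
        rw [← h] at hbd
        omega
      have pab := D.pos_injective.ne nab
      have pcd := D.pos_injective.ne ncd
      obtain ⟨ab, sab, bab⟩ := hadj a b hab nab
      obtain ⟨cd, scd, bcd⟩ := hadj c d hcd ncd
      rw [sab, scd] at hs
      simp only [Finset.coe_union, Set.mem_union, Finset.mem_coe]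
      rcases lt_or_eq_of_le (show D.pos (π a) ≤ D.pos (π c) by omega) with h1 | h1
      · rcases lt_or_eq_of_le (show D.pos (π c) ≤ D.pos (π b) by omega) with h2 | h2
        · rcases lt_or_eq_of_le (show D.pos (π b) ≤ D.pos (π d) by omega) with h3 | h3
          · refine Or.inl (Or.inl (Finset.mem_image.2 ⟨((π a, π b, π c, π d), (bit a, bit c)),
              ?_, ?_⟩))
            · simp [interleavings, ab, cd, hs, h1, h2, h3]
            · simp [Φ, bab, bcd]
          · have hv := D.pos_injective h3
            obtain ⟨z0, z1⟩ := ZMod.eq_zero_and_eq_one_of_val_lt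
              (show (bit b).val < (bit d).val by omega)
            refine Or.inl (Or.inr (Finset.mem_image.2 ⟨(π b, π a, π c), ?_, ?_⟩))
            · rw [← hv] at cd hs
              simp only [wedges, Finset.mem_filter, Finset.mem_univ, true_and]
              exact ⟨ab.symm, cd.symm, by rw [D.side_comm, hs, D.side_comm], h1⟩
            · dsimp only
              rw [if_neg (by omega), if_neg (by omega)]
              simp only [Φ, ← hv, Prod.mk.injEq, true_and, z0, z1, and_true]
              refine ⟨?_, ?_⟩
              · rw [← z0, bab, add_sub_cancel_right]
              · rw [← z1, bcd, ← hv, add_sub_cancel_right]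
        · have hv := D.pos_injective h2
          obtain ⟨z0, z1⟩ := ZMod.eq_zero_and_eq_one_of_val_lt
            (show (bit c).val < (bit b).val by omega)
          refine Or.inl (Or.inr (Finset.mem_image.2 ⟨(π b, π a, π d), ?_, ?_⟩))
          · rw [hv] at cd hs
            simp only [wedges, Finset.mem_filter, Finset.mem_univ, true_and]
            exact ⟨ab.symm, cd, by rw [D.side_comm, hs], by omega⟩
          · dsimp only
            rw [if_neg (by omega), if_pos (by omega)]
            simp only [Φ, hv, Prod.mk.injEq, true_and, z0, z1]
            refine ⟨?_, ?_⟩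
            · rw [← z1, bab, add_sub_cancel_right]
            · rw [bcd, z0, hv]
      · have hv := D.pos_injective h1
        obtain ⟨z0, z1⟩ := ZMod.eq_zero_and_eq_one_of_val_lt
          (show (bit a).val < (bit c).val by omega)
        rcases lt_or_eq_of_le (show D.pos (π b) ≤ D.pos (π d) by omega) with h3 | h3
        · refine Or.inl (Or.inr (Finset.mem_image.2 ⟨(π a, π b, π d), ?_, ?_⟩))
          · rw [← hv] at cd hs
            simp [wedges, ab, cd, hs, h3]
          · dsimp only
            rw [if_pos (by omega)]
            simp only [Φ, ← hv, Prod.mk.injEq, true_and, z0, z1]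
            exact ⟨by rw [bab, z0], by rw [bcd, z1, hv]⟩
        · have hw := D.pos_injective h3
          obtain ⟨y0, y1⟩ := ZMod.eq_zero_and_eq_one_of_val_lt
            (show (bit b).val < (bit d).val by omega)
          refine Or.inr (Finset.mem_image.2 ⟨(π a, π b), ?_, ?_⟩)
          · rw [y0, z0, zero_add] at bab
            simp only [twists, Finset.mem_filter, Finset.mem_univ, true_and]
            exact ⟨ab, by omega, bab.symm⟩
          · simp [Φ, ← hv, ← hw, z0, z1, y0, y1]
    · rintro ⟨a, b, c, d⟩ - ⟨a', b', c', d'⟩ - h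
      simp only [Prod.mk.injEq] at h ⊢
      exact ⟨hΦ h.1, hΦ h.2.1, hΦ h.2.2.1, hΦ h.2.2.2⟩
  have h₁ : T₁.card ≤ 4 * D.interleavings.card := by
    refine Finset.card_image_le.trans ?_
    rw [Finset.card_product, Finset.card_univ, Fintype.card_prod, ZMod.card]
    omega
  have h₂ : T₂.card ≤ D.wedges.card := Finset.card_image_le
  have h₃ : T₃.card ≤ (D.twists β).card := Finset.card_image_le
  have := Finset.card_union_le (T₁ ∪ T₂) T₃
  have := Finset.card_union_le T₁ T₂
  omega

open scoped Classical in
/-- A bound for the number of wedges when the vertices outside `S` have at most one neighbor on each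
side of the spine. -/
lemma card_wedges_le [Fintype W] (D : SpineDrawing H) (S : Finset W) (g : ℕ)
    (hout : ∀ v ∉ S, ∀ s, (D.sideNeighbors s v).card ≤ 1)
    (hin : ∀ v ∈ S, (D.sideNeighbors true v).card * ((D.sideNeighbors true v).card - 1) +
      (D.sideNeighbors false v).card * ((D.sideNeighbors false v).card - 1) ≤ 2 * g) :
    D.wedges.card ≤ g * S.card := by
  refine Finset.card_le_mul_card_image_of_maps_to (f := fun q => q.1) ?_ g ?_
  · rintro ⟨v, b, d⟩ hq
    simp only [wedges, Finset.mem_filter, Finset.mem_univ, true_and] at hq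
    obtain ⟨hb, hd, hs, hlt⟩ := hq
    by_contra hv
    have := Finset.card_le_one.1 (hout v hv (D.side v b)) b (mem_sideNeighbors.2 ⟨hb, rfl⟩) d
      (mem_sideNeighbors.2 ⟨hd, hs.symm⟩)
    rw [this] at hlt
    exact lt_irrefl _ hlt
  · intro v hv
    let U : Finset (W × W) :=
      (D.sideNeighbors true v).offDiag ∪ (D.sideNeighbors false v).offDiag
    have hU : U.card ≤ 2 * g := by
      refine (Finset.card_union_le _ _).trans (le_trans (le_of_eq ?_) (hin v hv))
      rw [Finset.offDiag_card, Finset.offDiag_card, Nat.mul_sub_one, Nat.mul_sub_one]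
    have hsymm : (U.filter fun p => D.pos p.1 < D.pos p.2).card ≤
        (U.filter fun p => D.pos p.2 < D.pos p.1).card := by
      refine Finset.card_le_card_of_injOn Prod.swap ?_ Prod.swap_injective.injOn
      rintro ⟨b, d⟩ h
      simp only [U, Finset.coe_filter, Set.mem_ofPred_eq, Finset.mem_union,
        Finset.mem_offDiag, Prod.swap_prod_mk] at h ⊢
      tauto
    have hdisj : Disjoint (U.filter fun p => D.pos p.1 < D.pos p.2)
        (U.filter fun p => D.pos p.2 < D.pos p.1) := by
      rw [Finset.disjoint_filter]
      intro p _ h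
      exact h.le.not_gt
    have hsum : (U.filter fun p => D.pos p.1 < D.pos p.2).card +
        (U.filter fun p => D.pos p.2 < D.pos p.1).card ≤ U.card := by
      rw [← Finset.card_union_of_disjoint hdisj]
      exact Finset.card_le_card (Finset.union_subset (Finset.filter_subset _ _)
        (Finset.filter_subset _ _))
    have hfib : (D.wedges.filter fun q => q.1 = v).card ≤
        (U.filter fun p => D.pos p.1 < D.pos p.2).card := by
      refine Finset.card_le_card_of_injOn Prod.snd ?_ ?_
      · rintro ⟨w, b, d⟩ h
        simp only [wedges, Finset.coe_filter, Finset.mem_filter, Finset.mem_univ, true_and,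
          Set.mem_ofPred_eq] at h
        obtain ⟨⟨hb, hd, hs, hlt⟩, rfl⟩ := h
        have hne : b ≠ d := fun h => by simp [h] at hlt
        simp only [U, Finset.coe_filter, Set.mem_ofPred_eq, Finset.mem_union,
          Finset.mem_offDiag, mem_sideNeighbors]
        refine ⟨?_, hlt⟩
        cases h : D.side w b
        · exact Or.inr ⟨⟨hb, rfl⟩, ⟨hd, by rw [← hs, h]⟩, hne⟩
        · exact Or.inl ⟨⟨hb, rfl⟩, ⟨hd, by rw [← hs, h]⟩, hne⟩
      · rintro ⟨w, p⟩ h ⟨w', p'⟩ h' heq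
        simp only [Finset.coe_filter, Set.mem_ofPred_eq] at h h'
        rw [h.2, h'.2]
        simpa using heq
    omega

end SpineDrawing

/-- The Gray code of a sequence: the sums of consecutive terms. -/
def gray {m : ℕ} (y : Fin m → ZMod 2) : Fin m → ZMod 2 :=
  fun i => y i + (Fin.cons 0 y : Fin (m + 1) → ZMod 2) i.castSucc

lemma cons_castSucc {m : ℕ} (y : Fin (m + 1) → ZMod 2) (i : Fin (m + 1)) :
    (Fin.cons 0 y : Fin (m + 2) → ZMod 2) i.castSucc =
      (Fin.cons 0 (Fin.init y) : Fin (m + 1) → ZMod 2) i := by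
  cases i using Fin.cases with
  | zero => rfl
  | succ i => rw [← Fin.succ_castSucc, Fin.cons_succ, Fin.cons_succ]; rfl

lemma init_gray {m : ℕ} (y : Fin (m + 1) → ZMod 2) :
    Fin.init (gray y) = gray (Fin.init y) := by
  funext i
  simp only [Fin.init, gray, cons_castSucc]

lemma sum_gray {m : ℕ} (y : Fin m → ZMod 2) :
    ∑ i, gray y i = (Fin.cons 0 y : Fin (m + 1) → ZMod 2) (Fin.last m) := by
  have h1 := Fin.sum_univ_castSucc (Fin.cons 0 y : Fin (m + 1) → ZMod 2)
  rw [Fin.sum_univ_succ] at h1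
  simp only [Fin.cons_zero, Fin.cons_succ, zero_add] at h1
  simp only [gray, Finset.sum_add_distrib]
  rw [h1]
  generalize (∑ i, (Fin.cons 0 y : Fin (m + 1) → ZMod 2) (Fin.castSucc i)) = a
  rw [add_right_comm, CharTwo.add_self_eq_zero, zero_add]

lemma gray_last {m : ℕ} (y : Fin (m + 1) → ZMod 2) :
    gray y (Fin.last m) = y (Fin.last m) + ∑ i, gray (Fin.init y) i := by
  rw [sum_gray, gray, cons_castSucc]

/-- The sum of the first four terms of a sequence. -/
def headParity {m : ℕ} (y : Fin m → ZMod 2) : ZMod 2 := ∑ i, if i.val < 4 then y i else 0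

/-- The sum of all but the first four terms of a sequence. -/
def tailParity {m : ℕ} (y : Fin m → ZMod 2) : ZMod 2 := ∑ i, if i.val < 4 then 0 else y i

lemma headParity_add_tailParity {m : ℕ} (y : Fin m → ZMod 2) :
    headParity y + tailParity y = ∑ i, y i := by
  rw [headParity, tailParity, ← Finset.sum_add_distrib]
  exact Finset.sum_congr rfl fun i _ => by split_ifs <;> simp

lemma headParity_init {m : ℕ} (hm : 4 ≤ m) (y : Fin (m + 1) → ZMod 2) :
    headParity (Fin.init y) = headParity y := by
  rw [headParity, headParity, Fin.sum_univ_castSucc]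
  simp [Fin.init, hm]

lemma tailParity_eq_init_add {m : ℕ} (hm : 4 ≤ m) (y : Fin (m + 1) → ZMod 2) :
    tailParity y = tailParity (Fin.init y) + y (Fin.last m) := by
  rw [tailParity, tailParity, Fin.sum_univ_castSucc]
  simp [Fin.init, hm]

/-- The points of the spine: `(0, x)` and `(1, y)` are vertices of the two halves of the cube, and
`(2, y)` is an extra point for the edge that joins the halves at `(1, y)`. -/
abbrev CubePoint (m : ℕ) := Fin 3 × (Fin m → ZMod 2)

/-- The links between the points of the spine: the edges of two hypercubes, and an edge or a path of
length two from `(0, gray y)` to `(1, y)`. -/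
inductive Link {m : ℕ} : CubePoint m → CubePoint m → Prop
  | flip (k : Fin 3) (hk : k ≠ 2) (x : Fin m → ZMod 2) (i : Fin m) :
      Link (k, x) (k, x + Pi.single i 1)
  | direct (y : Fin m → ZMod 2) (hy : headParity y = 0) : Link (0, gray y) (1, y)
  | enter (y : Fin m → ZMod 2) (hy : headParity y = 1) : Link (0, gray y) (2, y)
  | leave (y : Fin m → ZMod 2) (hy : headParity y = 1) : Link (2, y) (1, y)

/-- The graph of the links. -/
def subdividedCube (m : ℕ) : SimpleGraph (CubePoint m) := SimpleGraph.fromRel Link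

namespace CubePoint

variable {m : ℕ}

/-- The point obtained by deleting the last bit. -/
def proj (w : CubePoint (m + 1)) : CubePoint m := (w.1, Fin.init w.2)

/-- The parity by which the order of the two lifts of a point is determined. -/
def shift (p : CubePoint m) : ZMod 2 := (if p.1 = 1 then 0 else 1) + ∑ i, p.2 i

/-- Which of the two lifts of its projection a point is, in the order of the spine. -/
def bit (w : CubePoint (m + 1)) : ZMod 2 := w.2 (Fin.last m) + shift (proj w)

/-- The difference of the bits of the ends of a lift of a link. -/
def voltage (p q : CubePoint m) : ZMod 2 :=
  if p.1 = 0 ∧ q.1 ≠ 0 then 1 + tailParity q.2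
  else if q.1 = 0 ∧ p.1 ≠ 0 then 1 + tailParity p.2 else 1

lemma voltage_comm (p q : CubePoint m) : voltage p q = voltage q p := by
  unfold voltage
  split_ifs <;> first | rfl | tauto

lemma proj_bit_injective {w u : CubePoint (m + 1)} (h : proj w = proj u) (hb : bit w = bit u) :
    w = u := by
  unfold bit at hb
  rw [h, add_left_inj] at hb
  obtain ⟨h1, h2⟩ := Prod.ext_iff.1 h
  dsimp only [proj] at h1 h2
  refine Prod.ext h1 ?_
  rw [← Fin.snoc_init_self w.2, ← Fin.snoc_init_self u.2, h2, hb]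

lemma link_proj (hm : 4 ≤ m) {w u : CubePoint (m + 1)} (h : Link w u) :
    (w.1 ≠ 2 ∧ proj w = proj u) ∨
      (Link (proj w) (proj u) ∧ bit u = bit w + voltage (proj w) (proj u)) := by
  cases h with
  | flip k hk x i =>
    cases i using Fin.lastCases with
    | last =>
      refine Or.inl ⟨hk, Prod.ext rfl ?_⟩
      funext j
      simp [proj, Fin.init, (Fin.castSucc_lt_last j).ne]
    | cast i =>
      have hi : Fin.init (x + Pi.single i.castSucc 1) = Fin.init x + Pi.single i 1 := by
        funext j
        simp [Fin.init, Pi.single_apply]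
      refine Or.inr ⟨?_, ?_⟩
      · simp only [proj, hi]
        exact Link.flip k hk _ i
      · have hv : voltage (proj (k, x)) (proj (k, x + Pi.single i.castSucc 1)) = 1 := by
          unfold voltage
          rw [if_neg (by simp only [proj]; tauto), if_neg (by simp only [proj]; tauto)]
        rw [hv]
        simp only [bit, proj, shift, hi, Pi.add_apply, Finset.sum_add_distrib,
          Pi.single_apply, (Fin.castSucc_lt_last i).ne', if_false, add_zero]
        simp only [Finset.sum_ite_eq', Finset.mem_univ, if_true, add_assoc]
        congr
  | direct y hy =>
    refine Or.inr ⟨?_, ?_⟩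
    · simp only [proj, init_gray]
      exact Link.direct _ (by rw [headParity_init hm, hy])
    · have h := headParity_add_tailParity (Fin.init y)
      rw [headParity_init hm, hy, zero_add] at h
      have hv : voltage (proj (0, gray y)) (proj (1, y)) = 1 + ∑ i, Fin.init y i := by
        rw [← h]; rfl
      have hb : bit (1, y) = y (Fin.last m) + (0 + ∑ i, Fin.init y i) := rfl
      have hg : bit (0, gray y) = gray y (Fin.last m) + (1 + ∑ i, Fin.init (gray y) i) := rfl
      rw [hv, hb, hg, init_gray, gray_last]
      generalize (∑ i, gray (Fin.init y) i) = a
      generalize (∑ i, Fin.init y i) = b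
      generalize y (Fin.last m) = c
      revert a b c
      decide
  | enter y hy =>
    refine Or.inr ⟨?_, ?_⟩
    · simp only [proj, init_gray]
      exact Link.enter _ (by rw [headParity_init hm, hy])
    · have h := headParity_add_tailParity (Fin.init y)
      rw [headParity_init hm, hy] at h
      have hv : voltage (proj (0, gray y)) (proj (2, y)) = 1 + tailParity (Fin.init y) := rfl
      have hb : bit (2, y) = y (Fin.last m) + (1 + ∑ i, Fin.init y i) := rfl
      have hg : bit (0, gray y) = gray y (Fin.last m) + (1 + ∑ i, Fin.init (gray y) i) := rfl
      rw [hv, hb, hg, init_gray, gray_last, ← h]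
      generalize (∑ i, gray (Fin.init y) i) = a
      generalize tailParity (Fin.init y) = b
      generalize y (Fin.last m) = c
      revert a b c
      decide
  | leave y hy =>
    refine Or.inr ⟨Link.leave _ (by rw [headParity_init hm, hy]), ?_⟩
    have hv : voltage (proj (2, y)) (proj (1, y)) = 1 := rfl
    have hb : bit (1, y) = y (Fin.last m) + (0 + ∑ i, Fin.init y i) := rfl
    have hg : bit (2, y) = y (Fin.last m) + (1 + ∑ i, Fin.init y i) := rfl
    rw [hv, hb, hg]
    generalize (∑ i, Fin.init y i) = b
    generalize y (Fin.last m) = c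
    revert b c
    decide

lemma adj_proj (hm : 4 ≤ m) {w u : CubePoint (m + 1)} (h : (subdividedCube (m + 1)).Adj w u) :
    (w.1 ≠ 2 ∧ proj w = proj u) ∨ ((subdividedCube m).Adj (proj w) (proj u) ∧
      proj w ≠ proj u ∧ bit u = bit w + voltage (proj w) (proj u)) := by
  by_cases hp : proj w = proj u
  · left
    refine ⟨?_, hp⟩
    have hk : w.1 = u.1 := (Prod.ext_iff.1 hp).1
    rcases h.2 with h' | h'
    · intro h2
      rw [h2] at hk
      cases h' with
      | flip k hk' x i => exact hk' h2
      | leave y hy => simp at hk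
      | direct y hy => simp at h2
      | enter y hy => simp at h2
    · intro h2
      rw [h2] at hk
      cases h' with
      | flip k hk' x i => exact hk' h2
      | leave y hy => simp at h2
      | direct y hy => simp at h2
      | enter y hy => simp at hk
  · right
    rcases h.2 with h' | h'
    · rcases link_proj hm h' with h'' | h''
      · exact absurd h''.2 hp
      · exact ⟨⟨hp, Or.inl h''.1⟩, hp, h''.2⟩
    · rcases link_proj hm h' with h'' | h''
      · exact absurd h''.2.symm hp
      · refine ⟨⟨hp, Or.inr h''.1⟩, hp, ?_⟩
        rw [h''.2, voltage_comm, add_assoc, CharTwo.add_self_eq_zero, add_zero]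

end CubePoint

namespace SpineDrawing

open CubePoint

variable {m : ℕ}

/-- The spine drawing in which each vertex is replaced by two consecutive ones, and the new edge
between them is drawn on the side where the vertex has fewer edges. -/
noncomputable def double (D : SpineDrawing (subdividedCube m)) :
    SpineDrawing (subdividedCube (m + 1)) where
  pos w := 2 * D.pos (proj w) + (bit w).val
  pos_injective := by
    intro w u h
    have h : 2 * D.pos (proj w) + (bit w).val = 2 * D.pos (proj u) + (bit u).val := h
    have h1 := ZMod.val_lt (bit w)
    have h2 := ZMod.val_lt (bit u)
    exact proj_bit_injective (D.pos_injective (by omega)) (ZMod.val_injective 2 (by omega))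
  side w u := if proj w = proj u then
      decide ((D.sideNeighbors true (proj w)).card ≤ (D.sideNeighbors false (proj w)).card)
    else D.side (proj w) (proj u)
  side_comm w u := by
    by_cases h : proj w = proj u
    · rw [if_pos h, if_pos h.symm, h]
    · rw [if_neg h, if_neg (Ne.symm h), D.side_comm]

lemma card_interleavings_double_le (hm : 4 ≤ m) (D : SpineDrawing (subdividedCube m)) :
    D.double.interleavings.card ≤
      4 * D.interleavings.card + D.wedges.card + (D.twists voltage).card := by
  refine card_interleavings_le_of_double D D.double voltage proj bit (fun w => rfl) ?_
  intro w u h hp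
  rcases adj_proj hm h with h' | h'
  · exact absurd h'.2 hp
  · exact ⟨h'.1, if_neg hp, h'.2.2⟩

/-- The edges at each vertex are divided evenly between the two sides of the spine, and extra points
have at most one edge on each side. -/
structure Balanced (D : SpineDrawing (subdividedCube m)) : Prop where
  extra : ∀ w : CubePoint m, w.1 = 2 → ∀ s, (D.sideNeighbors s w).card ≤ 1
  half : ∀ w : CubePoint m, w.1 ≠ 2 → ∀ s, 2 * (D.sideNeighbors s w).card ≤ m + 2
  total : ∀ w : CubePoint m, w.1 ≠ 2 →
    (D.sideNeighbors true w).card + (D.sideNeighbors false w).card ≤ m + 1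

open scoped Classical in
lemma card_sideNeighbors_double_le (hm : 4 ≤ m) (D : SpineDrawing (subdividedCube m)) (s : Bool)
    (w : CubePoint (m + 1)) :
    (D.double.sideNeighbors s w).card ≤ (D.sideNeighbors s (proj w)).card +
      if w.1 ≠ 2 ∧ decide ((D.sideNeighbors true (proj w)).card ≤
        (D.sideNeighbors false (proj w)).card) = s then 1 else 0 := by
  rw [← Finset.card_filter_add_card_filter_not (s := D.double.sideNeighbors s w)
    (fun u => proj w ≠ proj u)]
  refine Nat.add_le_add ?_ ?_
  · refine Finset.card_le_card_of_injOn proj ?_ ?_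
    · intro u hu
      simp only [Finset.coe_filter, Set.mem_ofPred_eq, mem_sideNeighbors] at hu
      obtain ⟨⟨hadj, hs⟩, hp⟩ := hu
      rcases adj_proj hm hadj with h | h
      · exact absurd h.2 hp
      · exact mem_sideNeighbors.2 ⟨h.1, by rw [← hs]; exact (if_neg hp).symm⟩
    · intro u hu v hv huv
      simp only [Finset.coe_filter, Set.mem_ofPred_eq, mem_sideNeighbors] at hu hv
      rcases adj_proj hm hu.1.1 with h | h
      · exact absurd h.2 hu.2
      rcases adj_proj hm hv.1.1 with h' | h'
      · exact absurd h'.2 hv.2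
      refine proj_bit_injective huv ?_
      rw [h.2.2, h'.2.2, huv]
  · split_ifs with hc
    · rw [Finset.card_le_one]
      intro u hu v hv
      simp only [Finset.mem_filter, mem_sideNeighbors, not_not] at hu hv
      have key : ∀ a b c : ZMod 2, a ≠ b → a ≠ c → b = c := by decide
      refine proj_bit_injective (hu.2.symm.trans hv.2) (key (bit w) _ _ ?_ ?_)
      · exact fun h => hu.1.1.ne (proj_bit_injective hu.2 h)
      · exact fun h => hv.1.1.ne (proj_bit_injective hv.2 h)
    · rw [Nat.le_zero, Finset.card_eq_zero, Finset.filter_eq_empty_iff]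
      intro u hu hp
      rw [not_not] at hp
      rw [mem_sideNeighbors] at hu
      rcases adj_proj hm hu.1 with h | h
      · refine hc ⟨h.1, ?_⟩
        rw [← hu.2]
        exact (if_pos hp).symm
      · exact h.2.1 hp

lemma Balanced.double (hm : 4 ≤ m) {D : SpineDrawing (subdividedCube m)} (hD : D.Balanced) :
    D.double.Balanced where
  extra w hw s := by
    have h := D.card_sideNeighbors_double_le hm s w
    rw [if_neg (by tauto)] at h
    exact h.trans (hD.extra (proj w) hw s)
  half w hw s := by
    have h := D.card_sideNeighbors_double_le hm s w
    have h1 := hD.half (proj w) hw s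
    have h2 := hD.total (proj w) hw
    split_ifs at h with hc
    · obtain ⟨-, rfl⟩ := hc
      by_cases hle : (D.sideNeighbors true (proj w)).card ≤ (D.sideNeighbors false (proj w)).card
      · simp only [hle, decide_true] at h ⊢
        omega
      · simp only [hle, decide_false] at h ⊢
        omega
    · omega
  total w hw := by
    have h := D.card_sideNeighbors_double_le hm true w
    have h' := D.card_sideNeighbors_double_le hm false w
    have h2 := hD.total (proj w) hw
    by_cases hle : (D.sideNeighbors true (proj w)).card ≤ (D.sideNeighbors false (proj w)).card
    · simp [hle, hw] at h h'
      omega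
    · simp [hle, hw] at h h'
      omega

lemma mul_pred_add_mul_pred_le {a b : ℕ} (ha : 2 * a ≤ m + 2) (hb : 2 * b ≤ m + 2)
    (hab : a + b ≤ m + 1) : a * (a - 1) + b * (b - 1) ≤ 2 * (m ^ 2 / 4) := by
  have mono : ∀ {x y : ℕ}, x ≤ y → x * (x - 1) ≤ y * (y - 1) := fun h =>
    Nat.mul_le_mul h (Nat.sub_le_sub_right h 1)
  have even : ∀ k x y, 2 * k = m → x ≤ k → y ≤ k + 1 →
      x * (x - 1) + y * (y - 1) ≤ 2 * (m ^ 2 / 4) := by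
    rintro k x y rfl hx hy
    have h1 := mono hx
    have h2 := mono hy
    have h3 : (2 * k) ^ 2 / 4 = k * k := by
      rw [show (2 * k) ^ 2 = 4 * (k * k) by ring, Nat.mul_div_cancel_left _ (by norm_num)]
    have h4 : k * (k - 1) + (k + 1) * (k + 1 - 1) = 2 * (k * k) := by
      cases k with
      | zero => rfl
      | succ k => simp only [Nat.add_sub_cancel]; ring
    rw [h3]
    omega
  rcases Nat.even_or_odd' m with ⟨k, hk | hk⟩
  · rcases Nat.lt_or_ge k a with h | h
    · rw [add_comm]
      exact even k b a hk.symm (by omega) (by omega)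
    · exact even k a b hk.symm h (by omega)
  · have h1 := mono (show a ≤ k + 1 by omega)
    have h2 := mono (show b ≤ k + 1 by omega)
    have h3 : m ^ 2 / 4 = k * k + k := by
      rw [hk, show (2 * k + 1) ^ 2 = 4 * (k * k + k) + 1 by ring]
      omega
    have h4 : (k + 1) * (k + 1 - 1) = k * k + k := by simp only [Nat.add_sub_cancel]; ring
    omega

lemma Balanced.card_wedges_le {D : SpineDrawing (subdividedCube m)} (hD : D.Balanced) :
    D.wedges.card ≤ m ^ 2 / 4 * 2 ^ (m + 1) := by
  have h := D.card_wedges_le (Finset.univ.filter fun w : CubePoint m => w.1 ≠ 2) (m ^ 2 / 4)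
    (fun w hw s => hD.extra w (by simpa using hw) s) ?_
  · refine h.trans (le_of_eq ?_)
    congr 1
    have : (Finset.univ.filter fun w : CubePoint m => w.1 ≠ 2) =
        (Finset.univ.filter fun k : Fin 3 => k ≠ 2) ×ˢ Finset.univ := by
      ext ⟨k, y⟩
      simp
    rw [this, Finset.card_product, show (Finset.univ.filter fun k : Fin 3 => k ≠ 2).card = 2 by
      decide, Finset.card_univ, Fintype.card_fun, ZMod.card, Fintype.card_fin]
    ring
  · intro w hw
    have hw : w.1 ≠ 2 := by simpa using hw
    have h1 := hD.half w hw true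
    have h2 := hD.half w hw false
    have h3 := hD.total w hw
    exact mul_pred_add_mul_pred_le h1 h2 h3

open scoped Classical in
lemma card_twists_voltage_le (D : SpineDrawing (subdividedCube m)) :
    (D.twists voltage).card ≤
      (Finset.univ.filter fun y : Fin m → ZMod 2 => tailParity y = 1).card := by
  let A : (Fin m → ZMod 2) → CubePoint m := fun y => (0, gray y)
  let B : (Fin m → ZMod 2) → CubePoint m := fun y => (if headParity y = 0 then 1 else 2, y)
  refine le_trans (Finset.card_le_card ?_) (Finset.card_image_le
    (f := fun y => if D.pos (A y) < D.pos (B y) then (A y, B y) else (B y, A y)))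
  have link : ∀ p q : CubePoint m, (subdividedCube m).Adj p q → p.1 = 0 → q.1 ≠ 0 →
      p = A q.2 ∧ q = B q.2 := by
    intro p q h hp hq
    rcases h.2 with h | h <;> cases h with
    | flip k hk x i => exact absurd hp hq
    | direct y hy => first | exact ⟨rfl, by simp [B, hy]⟩ | simp at hp
    | enter y hy => first | exact ⟨rfl, by simp [B, hy]⟩ | simp at hp
    | leave y hy => simp at hp
  rintro ⟨p, q⟩ h
  simp only [twists, Finset.mem_filter, Finset.mem_univ, true_and] at h
  obtain ⟨hadj, hlt, hv⟩ := h
  have tail : ∀ a : ZMod 2, 1 + a = 0 → a = 1 := by decide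
  unfold voltage at hv
  split_ifs at hv with h1 h2
  · obtain ⟨hA, hB⟩ := link p q hadj h1.1 h1.2
    refine Finset.mem_image.2 ⟨q.2, by simpa using tail _ hv, ?_⟩
    rw [← hA, ← hB, if_pos hlt]
  · obtain ⟨hA, hB⟩ := link q p hadj.symm h2.1 h2.2
    refine Finset.mem_image.2 ⟨p.2, by simpa using tail _ hv, ?_⟩
    rw [← hA, ← hB, if_neg hlt.le.not_gt]
  · simp at hv

lemma card_tailParity_le (hm : 4 ≤ m) :
    (Finset.univ.filter fun y : Fin (m + 1) → ZMod 2 => tailParity y = 1).card ≤ 2 ^ m := by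
  have h : Fintype.card (Fin m → ZMod 2) = 2 ^ m := by simp
  rw [← h, ← Finset.card_univ]
  refine Finset.card_le_card_of_injOn Fin.init (fun _ _ => Finset.mem_coe.2 (Finset.mem_univ _)) ?_
  intro y hy z hz hyz
  simp only [Finset.coe_filter, Finset.mem_univ, true_and, Set.mem_ofPred_eq,
    tailParity_eq_init_add hm] at hy hz
  rw [← hz, hyz, add_right_inj] at hy
  rw [← Fin.snoc_init_self y, ← Fin.snoc_init_self z, hyz, hy]

lemma card_tailParity_four :
    (Finset.univ.filter fun y : Fin 4 → ZMod 2 => tailParity y = 1).card = 0 := by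
  rw [Finset.card_eq_zero, Finset.filter_eq_empty_iff]
  intro y _
  simp [tailParity]

end SpineDrawing

namespace FourBits

/-- The positions on the spine of the points of `CubePoint 4`, in the order of their codes. -/
def positions : List ℕ :=
  [35, 33, 9, 10, 36, 32, 8, 11, 29, 30, 14, 13, 28, 31, 15, 12, 0, 1, 39, 2, 5, 4, 6, 3, 25, 24,
  26, 23, 19, 21, 18, 22, 40, 34, 37, 41, 7, 42, 43, 38, 27, 44, 45, 16, 46, 20, 17, 47]

/-- The positions of the ends of the links above the spine. -/
def above : List (ℕ × ℕ) :=
  [(0, 25), (0, 35), (0, 39), (1, 4), (1, 24), (1, 34), (2, 3), (2, 23), (3, 22), (4, 11),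
  (4, 21), (5, 6), (5, 7), (5, 19), (6, 18), (8, 9), (8, 11), (8, 15), (9, 10), (9, 14),
  (10, 13), (11, 12), (12, 13), (13, 20), (14, 15), (14, 19), (15, 16), (17, 18), (18, 19),
  (21, 22), (21, 24), (22, 23), (24, 31), (25, 26), (25, 27), (26, 39), (28, 29), (28, 31),
  (28, 36), (29, 30), (29, 35), (30, 33), (31, 32), (32, 33), (36, 38), (37, 39)]

/-- The positions of the ends of the links below the spine. -/
def below : List (ℕ × ℕ) :=
  [(0, 1), (0, 5), (1, 2), (2, 9), (2, 39), (3, 4), (3, 6), (3, 38), (4, 5), (6, 32), (6, 39),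
  (7, 8), (8, 36), (9, 35), (10, 11), (10, 33), (10, 37), (11, 32), (12, 15), (12, 26), (12, 31),
  (13, 14), (13, 30), (14, 29), (15, 28), (16, 23), (17, 30), (18, 22), (18, 26), (19, 21),
  (19, 25), (20, 21), (22, 29), (23, 24), (23, 26), (24, 25), (27, 28), (30, 31), (32, 36),
  (33, 34), (33, 35), (35, 36)]

/-- The number that codes a point. -/
def code (w : CubePoint 4) : ℕ :=
  16 * w.1.val + 8 * (w.2 0).val + 4 * (w.2 1).val + 2 * (w.2 2).val + (w.2 3).val

lemma code_lt (w : CubePoint 4) : code w < 48 := by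
  have h := w.1.isLt
  have h0 := ZMod.val_lt (w.2 0)
  have h1 := ZMod.val_lt (w.2 1)
  have h2 := ZMod.val_lt (w.2 2)
  have h3 := ZMod.val_lt (w.2 3)
  unfold code
  omega

lemma code_injective : Function.Injective code := by
  intro w u hwu
  have h0 := ZMod.val_lt (w.2 0)
  have h1 := ZMod.val_lt (w.2 1)
  have h2 := ZMod.val_lt (w.2 2)
  have h3 := ZMod.val_lt (w.2 3)
  have k0 := ZMod.val_lt (u.2 0)
  have k1 := ZMod.val_lt (u.2 1)
  have k2 := ZMod.val_lt (u.2 2)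
  have k3 := ZMod.val_lt (u.2 3)
  unfold code at hwu
  refine Prod.ext (Fin.ext (by omega)) (funext fun i => ZMod.val_injective 2 ?_)
  match i with
  | 0 => omega
  | 1 => omega
  | 2 => omega
  | 3 => omega

/-- The position of a point on the spine. -/
def position (w : CubePoint 4) : ℕ := positions.getD (code w) 0

lemma position_injective : Function.Injective position := by
  intro w u h
  have hn : positions.Nodup := by decide +kernel
  have hw : code w < positions.length := code_lt w
  have hu : code u < positions.length := code_lt u
  unfold position at h
  rw [List.getD_eq_getElem _ _ hw, List.getD_eq_getElem _ _ hu] at h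
  exact code_injective (hn.getElem_inj_iff.1 h)

/-- The positions of two points, in increasing order. -/
def span (w u : CubePoint 4) : ℕ × ℕ :=
  (min (position w) (position u), max (position w) (position u))

lemma span_comm (w u : CubePoint 4) : span w u = span u w := by
  rw [span, span, min_comm, max_comm]

/-- A spine drawing of the subdivided cube with four bits. -/
def drawing : SpineDrawing (subdividedCube 4) where
  pos := position
  pos_injective := position_injective
  side w u := decide (span w u ∈ above)
  side_comm w u := by rw [span_comm]

lemma span_mem_of_flip : ∀ k : Fin 3, k ≠ 2 → ∀ (x : Fin 4 → ZMod 2) (i : Fin 4),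
    span (k, x) (k, x + Pi.single i 1) ∈ above ++ below := by
  decide +kernel

lemma span_mem_of_direct : ∀ y : Fin 4 → ZMod 2, headParity y = 0 →
    span (0, gray y) (1, y) ∈ above ++ below := by
  decide +kernel

lemma span_mem_of_enter : ∀ y : Fin 4 → ZMod 2, headParity y = 1 →
    span (0, gray y) (2, y) ∈ above ++ below := by
  decide +kernel

lemma span_mem_of_leave : ∀ y : Fin 4 → ZMod 2, headParity y = 1 →
    span (2, y) (1, y) ∈ above ++ below := by
  decide +kernel

lemma span_mem {w u : CubePoint 4} (h : (subdividedCube 4).Adj w u) :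
    span w u ∈ above ++ below := by
  have link : ∀ {w u : CubePoint 4}, Link w u → span w u ∈ above ++ below := by
    intro w u h
    cases h with
    | flip k hk x i => exact span_mem_of_flip k hk x i
    | direct y hy => exact span_mem_of_direct y hy
    | enter y hy => exact span_mem_of_enter y hy
    | leave y hy => exact span_mem_of_leave y hy
  rcases h.2 with h | h
  · exact link h
  · exact span_comm w u ▸ link h

/-- The links on a given side of the spine. -/
def links (s : Bool) : List (ℕ × ℕ) := if s then above else below

lemma span_mem_links {w u : CubePoint 4} (h : (subdividedCube 4).Adj w u) :
    span w u ∈ links (drawing.side w u) := by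
  by_cases ha : span w u ∈ above
  · simp [links, drawing, ha]
  · simpa [links, drawing, ha] using (List.mem_append.1 (span_mem h)).resolve_left ha

/-- The pairs of links in a list that interleave. -/
def crossingPairs (l : List (ℕ × ℕ)) : List ((ℕ × ℕ) × (ℕ × ℕ)) :=
  (l ×ˢ l).filter fun p => p.1.1 < p.2.1 ∧ p.2.1 < p.1.2 ∧ p.1.2 < p.2.2

lemma length_crossingPairs :
    (crossingPairs (links true) ++ crossingPairs (links false)).length = 68 := by
  decide +kernel

lemma card_interleavings_le : drawing.interleavings.card ≤ 68 := by
  rw [← length_crossingPairs]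
  refine le_trans (Finset.card_le_card_of_injOn
    (t := (crossingPairs (links true) ++ crossingPairs (links false)).toFinset)
    (fun q => ((position q.1, position q.2.1), (position q.2.2.1, position q.2.2.2))) ?_ ?_)
    (List.toFinset_card_le _)
  · rintro ⟨a, b, c, d⟩ hq
    simp only [SpineDrawing.interleavings, Finset.coe_filter, Finset.mem_univ, true_and,
      Set.mem_ofPred_eq] at hq
    obtain ⟨hab, hcd, hs, hac, hcb, hbd⟩ := hq
    have h1 := span_mem_links hab
    have h2 := span_mem_links hcd
    rw [← hs] at h2
    change position a < position c at hac
    change position c < position b at hcb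
    change position b < position d at hbd
    rw [span, min_eq_left (hac.trans hcb).le, max_eq_right (hac.trans hcb).le] at h1
    rw [span, min_eq_left (hcb.trans hbd).le, max_eq_right (hcb.trans hbd).le] at h2
    rw [Finset.mem_coe, List.mem_toFinset, List.mem_append]
    have mem : ∀ s, (position a, position b) ∈ links s → (position c, position d) ∈ links s →
        ((position a, position b), (position c, position d)) ∈ crossingPairs (links s) := by
      intro s h1 h2
      simp only [crossingPairs, List.mem_filter, decide_eq_true_eq]
      exact ⟨List.mem_product.2 ⟨h1, h2⟩, hac, hcb, hbd⟩
    cases hside : drawing.side a b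
    · rw [hside] at h1 h2
      exact Or.inr (mem _ h1 h2)
    · rw [hside] at h1 h2
      exact Or.inl (mem _ h1 h2)
  · rintro ⟨a, b, c, d⟩ - ⟨a', b', c', d'⟩ - h
    simp only [Prod.mk.injEq] at h ⊢
    exact ⟨position_injective h.1.1, position_injective h.1.2, position_injective h.2.1,
      position_injective h.2.2⟩

/-- The links in a list with an end at a given position. -/
def linksAt (l : List (ℕ × ℕ)) (p : ℕ) : List (ℕ × ℕ) := l.filter fun q => q.1 = p ∨ q.2 = p

lemma card_sideNeighbors_le (s : Bool) (w : CubePoint 4) :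
    (drawing.sideNeighbors s w).card ≤ (linksAt (links s) (position w)).length := by
  refine le_trans (Finset.card_le_card_of_injOn
    (t := (linksAt (links s) (position w)).toFinset) (span w) ?_ ?_) (List.toFinset_card_le _)
  · intro u hu
    obtain ⟨hadj, rfl⟩ := SpineDrawing.mem_sideNeighbors.1 hu
    rw [Finset.mem_coe, List.mem_toFinset]
    simp only [linksAt, List.mem_filter, decide_eq_true_eq]
    refine ⟨span_mem_links hadj, ?_⟩
    rcases le_total (position w) (position u) with h | h
    · exact Or.inl (min_eq_left h)
    · exact Or.inr (max_eq_left h)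
  · intro u _ v _ h
    obtain ⟨h1, h2⟩ := Prod.ext_iff.1 h
    dsimp only [span] at h1 h2
    exact position_injective (by omega)

lemma length_linksAt_extra : ∀ y : Fin 4 → ZMod 2, ∀ s,
    (linksAt (links s) (position (2, y))).length ≤ 1 := by
  decide +kernel

lemma length_linksAt_le : ∀ k : Fin 3, k ≠ 2 → ∀ (y : Fin 4 → ZMod 2) (s : Bool),
    (linksAt (links s) (position (k, y))).length ≤ 3 := by
  decide +kernel

lemma length_linksAt_add_le : ∀ k : Fin 3, k ≠ 2 → ∀ y : Fin 4 → ZMod 2,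
    (linksAt (links true) (position (k, y))).length +
      (linksAt (links false) (position (k, y))).length ≤ 5 := by
  decide +kernel

lemma balanced : drawing.Balanced where
  extra := by
    rintro ⟨k, y⟩ rfl s
    exact (card_sideNeighbors_le s _).trans (length_linksAt_extra y s)
  half := by
    rintro ⟨k, y⟩ hk s
    have h1 := card_sideNeighbors_le s (k, y)
    have h2 := length_linksAt_le k hk y s
    omega
  total := by
    rintro ⟨k, y⟩ hk
    have h1 := card_sideNeighbors_le true (k, y)
    have h2 := card_sideNeighbors_le false (k, y)
    have h3 := length_linksAt_add_le k hk y
    omega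

end FourBits

lemma gray_add {m : ℕ} (x y : Fin m → ZMod 2) : gray (x + y) = gray x + gray y := by
  funext i
  cases m with
  | zero => exact i.elim0
  | succ m =>
    simp only [gray, Pi.add_apply]
    cases i using Fin.cases with
    | zero => simp
    | succ i => rw [← Fin.succ_castSucc, Fin.cons_succ, Fin.cons_succ, Fin.cons_succ,
        Pi.add_apply]; ring

lemma gray_cons_zero {m : ℕ} (z : Fin m → ZMod 2) :
    gray (Fin.cons 0 z : Fin (m + 1) → ZMod 2) = Fin.cons 0 (gray z) := by
  funext i
  cases i using Fin.cases with
  | zero => simp [gray]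
  | succ i => simp only [gray, Fin.cons_succ, ← Fin.succ_castSucc]

lemma gray_injective {m : ℕ} : Function.Injective (gray : (Fin m → ZMod 2) → _) := by
  induction m with
  | zero => exact Function.injective_of_subsingleton _
  | succ m ih =>
    intro x y h
    have hi : Fin.init x = Fin.init y := ih (by rw [← init_gray, ← init_gray, h])
    have hl := congrFun h (Fin.last m)
    rw [gray_last, gray_last, hi, add_left_inj] at hl
    rw [← Fin.snoc_init_self x, ← Fin.snoc_init_self y, hi, hl]

/-- The inverse of the Gray code. -/
noncomputable def ungray {m : ℕ} : (Fin m → ZMod 2) → Fin m → ZMod 2 :=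
  (Equiv.ofBijective gray (Finite.injective_iff_bijective.1 gray_injective)).symm

lemma gray_ungray {m : ℕ} (x : Fin m → ZMod 2) : gray (ungray x) = x :=
  (Equiv.ofBijective gray (Finite.injective_iff_bijective.1 gray_injective)).apply_symm_apply x

lemma ungray_gray {m : ℕ} (x : Fin m → ZMod 2) : ungray (gray x) = x :=
  gray_injective (gray_ungray _)

lemma ungray_injective {m : ℕ} : Function.Injective (ungray : (Fin m → ZMod 2) → _) :=
  Function.LeftInverse.injective gray_ungray

/-- The change of all but the last bit along an edge of the locally twisted cube, for a given last
bit. -/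
def flipVector {m : ℕ} (t : ZMod 2) (i : Fin m) : Fin m → ZMod 2 :=
  if t = 0 then Pi.single i 1 else gray (Pi.single i 1)

/-- The edges of the locally twisted cube, described by the change of the bits. -/
def TwistedStep {m : ℕ} (x y : Fin (m + 1) → ZMod 2) : Prop :=
  (x (Fin.last m) = y (Fin.last m) ∧
    ∃ i, Fin.init y = Fin.init x + flipVector (x (Fin.last m)) i) ∨
  (x (Fin.last m) ≠ y (Fin.last m) ∧ Fin.init x = Fin.init y)

lemma TwistedStep.symm {m : ℕ} {x y : Fin (m + 1) → ZMod 2} (h : TwistedStep x y) :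
    TwistedStep y x := by
  rcases h with ⟨h1, i, h2⟩ | ⟨h1, h2⟩
  · refine Or.inl ⟨h1.symm, i, ?_⟩
    funext j
    rw [h2, ← h1, Pi.add_apply, Pi.add_apply, add_assoc, CharTwo.add_self_eq_zero, add_zero]
  · exact Or.inr ⟨h1.symm, h2.symm⟩

lemma flipVector_succ {m : ℕ} (t : ZMod 2) (i : Fin m) :
    flipVector t i.succ = Fin.cons 0 (flipVector t i) := by
  have h : (Pi.single i.succ 1 : Fin (m + 1) → ZMod 2) = Fin.cons 0 (Pi.single i 1) := by
    funext j
    cases j using Fin.cases with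
    | zero => simp
    | succ j => simp [Pi.single_apply]
  unfold flipVector
  split_ifs
  · exact h
  · rw [h, gray_cons_zero]

lemma TwistedStep.cons {m : ℕ} {x y : Fin (m + 2) → ZMod 2} (h0 : x 0 = y 0)
    (h : TwistedStep (Fin.tail x) (Fin.tail y)) : TwistedStep x y := by
  rcases h with ⟨h1, i, h2⟩ | ⟨h1, h2⟩
  · refine Or.inl ⟨h1, i.succ, ?_⟩
    funext j
    rw [flipVector_succ]
    cases j using Fin.cases with
    | zero => simpa [Fin.init] using h0.symm
    | succ j => exact congrFun h2 j
  · refine Or.inr ⟨h1, ?_⟩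
    funext j
    cases j using Fin.cases with
    | zero => exact h0
    | succ j => exact congrFun h2 j

lemma twistedStep_twistedPartner {m : ℕ} {x : Fin (m + 3) → ZMod 2} (h0 : x 0 = 0) :
    TwistedStep x (twistedPartner x) := by
  have hlast : twistedPartner x (Fin.last (m + 2)) = x (Fin.last (m + 2)) := by
    have h1 : Fin.last (m + 2) ≠ 1 := by simp [Fin.ext_iff]
    have h2 : Fin.last (m + 2) ≠ 0 := by simp [Fin.ext_iff]
    simp only [twistedPartner, Function.update_of_ne h1, Function.update_of_ne h2]
  refine Or.inl ⟨hlast.symm, 0, ?_⟩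
  have hsingle : (Pi.single 0 1 : Fin (m + 2) → ZMod 2) = Fin.cons 1 0 := by
    funext j
    cases j using Fin.cases with
    | zero => simp
    | succ j => simp
  have hv : ∀ t : ZMod 2, flipVector t (0 : Fin (m + 2)) = Fin.cons 1 (Fin.cons t 0) := by
    intro t
    unfold flipVector
    rw [hsingle]
    funext j
    rcases (show t = 0 ∨ t = 1 by revert t; decide) with rfl | rfl
    · rw [if_pos rfl]
      cases j using Fin.cases with
      | zero => rfl
      | succ j =>
        cases j using Fin.cases with
        | zero => rfl
        | succ j => rfl
    · rw [if_neg one_ne_zero]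
      cases j using Fin.cases with
      | zero => simp [gray]
      | succ j =>
        rw [gray, ← Fin.succ_castSucc, Fin.cons_succ, Fin.cons_succ, Fin.cons_succ]
        cases j using Fin.cases with
        | zero => simp
        | succ j => rw [← Fin.succ_castSucc, Fin.cons_succ, Fin.cons_succ]; simp
  rw [hv]
  funext j
  cases j using Fin.cases with
  | zero => simp [Fin.init, twistedPartner, h0]
  | succ j =>
    cases j using Fin.cases with
    | zero => simp [Fin.init, twistedPartner]
    | succ j =>
      have h1 : (j.succ.succ).castSucc ≠ (1 : Fin (m + 3)) := by simp [Fin.ext_iff]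
      have h2 : (j.succ.succ).castSucc ≠ (0 : Fin (m + 3)) := by simp [Fin.ext_iff]
      rw [Fin.init, twistedPartner, Function.update_of_ne h1, Function.update_of_ne h2]
      simp [Fin.init]

lemma twistedStep_of_hypercubeGraph_two : ∀ x y : Fin 2 → ZMod 2, hammingDist x y = 1 →
    TwistedStep x y := by
  unfold TwistedStep
  decide

lemma twistedStep_of_adj (m : ℕ) {x y : Fin (m + 2) → ZMod 2} (h : (LTQ (m + 2)).Adj x y) :
    TwistedStep x y := by
  induction m with
  | zero => exact twistedStep_of_hypercubeGraph_two x y h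
  | succ m ih =>
    rcases h with ⟨h0, h⟩ | ⟨h0, rfl⟩ | ⟨h0, rfl⟩
    · exact TwistedStep.cons h0 (ih h)
    · exact twistedStep_twistedPartner h0
    · exact (twistedStep_twistedPartner h0).symm

/-- The point of the spine at which a vertex of the locally twisted cube is placed. -/
noncomputable def cubePoint {m : ℕ} (x : Fin (m + 1) → ZMod 2) : CubePoint m :=
  if x (Fin.last m) = 0 then (0, Fin.init x) else (1, ungray (Fin.init x))

lemma cubePoint_injective {m : ℕ} :
    Function.Injective (cubePoint : (Fin (m + 1) → ZMod 2) → _) := by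
  intro x y h
  have one : ∀ a b : ZMod 2, a ≠ 0 → b ≠ 0 → a = b := by decide
  unfold cubePoint at h
  rw [← Fin.snoc_init_self x, ← Fin.snoc_init_self y]
  split_ifs at h with h1 h2 h2
  · have hi : Fin.init x = Fin.init y := (Prod.ext_iff.1 h).2
    rw [hi, h1, h2]
  · simp at h
  · simp at h
  · rw [ungray_injective (Prod.ext_iff.1 h).2, one _ _ h1 h2]

lemma mem_range_cubePoint {m : ℕ} {w : CubePoint m} (hw : w.1 ≠ 2) : w ∈ Set.range cubePoint := by
  obtain ⟨k, y⟩ := w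
  fin_cases k
  · exact ⟨Fin.snoc y 0, by simp [cubePoint]⟩
  · exact ⟨Fin.snoc (gray y) 1, by simp [cubePoint, ungray_gray]⟩
  · exact absurd rfl hw

lemma eq_or_eq_of_adj_extra {m : ℕ} {w : CubePoint m} {y : Fin m → ZMod 2}
    (h : (subdividedCube m).Adj w (2, y)) : w = (0, gray y) ∨ w = (1, y) := by
  rcases h.2 with h | h
  · cases h with
    | flip k hk x i => exact absurd rfl hk
    | enter y hy => exact Or.inl rfl
  · cases h with
    | flip k hk x i => exact absurd rfl hk
    | leave y hy => exact Or.inr rfl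

lemma subdividedCube_adj_of_link {m : ℕ} {w u : CubePoint m} (h : Link w u) (hne : w ≠ u) :
    (subdividedCube m).Adj w u := ⟨hne, Or.inl h⟩

theorem crossingNumber_LTQ_le {m : ℕ} (hm : 1 ≤ m) {D : SpineDrawing (subdividedCube m)}
    (hD : D.Balanced) : crossingNumber (LTQ (m + 1)) ≤ D.interleavings.card := by
  obtain ⟨m, rfl⟩ := Nat.exists_eq_add_of_le' hm
  have matching : ∀ u v : Fin (m + 2) → ZMod 2, u (Fin.last (m + 1)) = 0 →
      v (Fin.last (m + 1)) ≠ 0 → Fin.init u = Fin.init v →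
      (subdividedCube (m + 1)).Adj (cubePoint u) (cubePoint v) ∨
      ∃ d, d ∉ Set.range cubePoint ∧ (subdividedCube (m + 1)).Adj (cubePoint u) d ∧
        (subdividedCube (m + 1)).Adj d (cubePoint v) ∧
        D.side (cubePoint u) d ≠ D.side d (cubePoint v) := by
    intro u v hu hv huv
    have hcu : cubePoint u = (0, gray (ungray (Fin.init v))) := by
      rw [gray_ungray, cubePoint, if_pos hu, huv]
    have hcv : cubePoint v = (1, ungray (Fin.init v)) := if_neg hv
    rw [hcu, hcv]
    generalize ungray (Fin.init v) = y
    have bits : ∀ a : ZMod 2, a = 0 ∨ a = 1 := by decide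
    rcases bits (headParity y) with hy | hy
    · exact Or.inl (subdividedCube_adj_of_link (Link.direct y hy) (by simp))
    · have h1 := subdividedCube_adj_of_link (Link.enter y hy) (by simp)
      have h2 := subdividedCube_adj_of_link (Link.leave y hy) (by simp)
      refine Or.inr ⟨(2, y), ?_, h1, h2, ?_⟩
      · rintro ⟨x, hx⟩
        unfold cubePoint at hx
        split_ifs at hx <;> simp at hx
      · intro hs
        have := Finset.card_le_one.1 (hD.extra (2, y) rfl (D.side (2, y) (1, y))) _
          (SpineDrawing.mem_sideNeighbors.2 ⟨h1.symm, by rw [D.side_comm, hs]⟩) _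
          (SpineDrawing.mem_sideNeighbors.2 ⟨h2, rfl⟩)
        simp at this
  refine D.crossingNumber_le cubePoint_injective ?_ ?_
  · intro u v huv
    have hne := huv.ne
    rcases twistedStep_of_adj m huv with ⟨hl, i, hi⟩ | ⟨hl, hi⟩
    · left
      refine ⟨cubePoint_injective.ne hne, Or.inl ?_⟩
      unfold cubePoint
      rw [← hl, hi]
      unfold flipVector
      split_ifs with h
      · exact Link.flip 0 (by decide) _ i
      · have : ungray (Fin.init u + gray (Pi.single i 1)) =
            ungray (Fin.init u) + Pi.single i 1 := by
          apply gray_injective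
          rw [gray_ungray, gray_add, gray_ungray]
        rw [this]
        exact Link.flip 1 (by decide) _ i
    · by_cases hu : u (Fin.last (m + 1)) = 0
      · exact matching u v hu (fun hv => hl (hu.trans hv.symm)) hi
      · have hv : v (Fin.last (m + 1)) = 0 := by
          have key : ∀ a b : ZMod 2, a ≠ b → a ≠ 0 → b = 0 := by decide
          exact key _ _ hl hu
        rcases matching v u hv hu hi.symm with h | ⟨d, hd, h1, h2, h3⟩
        · exact Or.inl h.symm
        · refine Or.inr ⟨d, hd, h2.symm, h1.symm, ?_⟩
          rw [D.side_comm (cubePoint u), D.side_comm d (cubePoint v)]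
          exact h3.symm
  · rintro ⟨k, y⟩ hd u v w huv hu hv hw
    obtain rfl : k = 2 := by
      by_contra hk
      exact hd (mem_range_cubePoint hk)
    have hne := cubePoint_injective.ne huv
    rcases eq_or_eq_of_adj_extra hu with hu | hu <;>
      rcases eq_or_eq_of_adj_extra hv with hv | hv <;>
      rcases eq_or_eq_of_adj_extra hw with hw | hw
    · exact Or.inl (cubePoint_injective (hw.trans hu.symm))
    · exact absurd (hu.trans hv.symm) hne
    · exact Or.inl (cubePoint_injective (hw.trans hu.symm))
    · exact Or.inr (cubePoint_injective (hw.trans hv.symm))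
    · exact Or.inr (cubePoint_injective (hw.trans hv.symm))
    · exact Or.inl (cubePoint_injective (hw.trans hu.symm))
    · exact absurd (hu.trans hv.symm) hne
    · exact Or.inl (cubePoint_injective (hw.trans hu.symm))

/-- The number of crossings of the drawing of `LTQ (j + 6)`. -/
def crossingBound : ℕ → ℕ
  | 0 => 400
  | j + 1 => 4 * crossingBound j + (j + 5) ^ 2 / 4 * 2 ^ (j + 6) + 2 ^ (j + 4)

lemma exists_balanced_drawing (j : ℕ) :
    ∃ D : SpineDrawing (subdividedCube (j + 5)), D.Balanced ∧
      D.interleavings.card ≤ crossingBound j := by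
  induction j with
  | zero =>
    refine ⟨FourBits.drawing.double, FourBits.balanced.double le_rfl, ?_⟩
    have h := FourBits.drawing.card_interleavings_double_le le_rfl
    have h1 := FourBits.card_interleavings_le
    have h2 := FourBits.balanced.card_wedges_le
    have h3 := FourBits.drawing.card_twists_voltage_le
    rw [SpineDrawing.card_tailParity_four] at h3
    norm_num at h2
    rw [crossingBound]
    omega
  | succ j ih =>
    obtain ⟨D, hD, hc⟩ := ih
    refine ⟨D.double, hD.double (by omega), ?_⟩
    have h := D.card_interleavings_double_le (by omega)
    have h2 : D.wedges.card ≤ (j + 5) ^ 2 / 4 * 2 ^ (j + 6) := hD.card_wedges_le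
    have h3 := D.card_twists_voltage_le.trans
      (SpineDrawing.card_tailParity_le (m := j + 4) (by omega))
    rw [crossingBound]
    omega

lemma cast_sq_div_four (k : ℕ) :
    ((k ^ 2 / 4 : ℕ) : ℝ) = ((k : ℝ) ^ 2 - (1 - (-1) ^ k) / 2) / 4 := by
  rcases Nat.even_or_odd' k with ⟨l, rfl | rfl⟩
  · rw [show (2 * l) ^ 2 = 4 * l ^ 2 by ring, Nat.mul_div_cancel_left _ (by norm_num),
      (even_two_mul l).neg_one_pow]
    push_cast
    ring
  · have : (2 * l + 1) ^ 2 / 4 = l ^ 2 + l := by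
      rw [show (2 * l + 1) ^ 2 = 4 * (l ^ 2 + l) + 1 by ring]
      omega
    rw [this, (odd_two_mul_add_one l).neg_one_pow]
    push_cast
    ring

lemma crossingBound_eq (j : ℕ) : (crossingBound j : ℝ) = 265 / 6 * 4 ^ (j + 2) -
    (((j : ℝ) + 6) ^ 2 + (15 + (-1) ^ (j + 5)) / 6) * 2 ^ (j + 3) := by
  induction j with
  | zero => norm_num [crossingBound]
  | succ j ih =>
    rw [crossingBound]
    have h := cast_sq_div_four (j + 5)
    push_cast at h ⊢
    rw [h, ih]
    ring

theorem theorem2p1 (n : ℕ) (hn : 6 ≤ n) :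
    ∃ k : ℕ, crossingNumber (LTQ n) = (k : ℕ∞) ∧
      (k : ℝ) ≤ 265 / 6 * 4 ^ (n - 4) -
        ((n : ℝ) ^ 2 + (15 + (-1) ^ (n - 1)) / 6) * 2 ^ (n - 3) := by
  obtain ⟨j, rfl⟩ := Nat.exists_eq_add_of_le' hn
  obtain ⟨D, hD, hc⟩ := exists_balanced_drawing j
  have h : crossingNumber (LTQ (j + 6)) ≤ crossingBound j :=
    (crossingNumber_LTQ_le (by omega) hD).trans (by exact_mod_cast hc)
  obtain ⟨k, hk⟩ := ENat.ne_top_iff_exists.1 (ne_top_of_le_ne_top (ENat.natCast_ne_top _) h)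
  refine ⟨k, hk.symm, ?_⟩
  rw [← hk] at h
  have hkc : (k : ℝ) ≤ crossingBound j := by exact_mod_cast h
  rw [crossingBound_eq] at hkc
  simpa using hkc
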